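/- Let $n\ge 2$, $d\ge 3$, $S=\mathbb C[x_0,\dots,x_n]$, and let $X:f=0$ be a reduced hypersurface of degree $d$ in $\mathbb P^n$ (so $f$ is homogeneous of degree $d$ and squarefree). Let $J_f=(\partial_{x_0}f,\dots,\partial_{x_n}f)$, let $M(f)=S/J_f$ be the Jacobian algebra, and let $\Sigma\subset\mathbb P^n$ be the singular subscheme of $X$, defined by $J_f$. Let $\dim\Sigma$ be its dimension as a topological space. If $\Sigma\neq\emptyset$ has dimension $r$, its degree $\deg\Sigma$ is defined by the fact that the leading term of the Hilbert polynomial of $M(f)$ is $\frac{\deg\Sigma}{r!}u^{r}$. Let $$0\to E_n\to\cdots\to E_2\to E_1\to S^{n+1}(1-d)\to S,\qquad E_k=\bigoplus_{i=1}^{m_k}S(1-d-d_{k,i}),\quad d_{k,i}\ge 0,$$ be the minimal graded free resolution of $M(f)$; here the last map is given by the partial derivatives of $f$, and $E_n\to\cdots\to E_1$ is a minimal graded free resolution of the kernel of that map (so $d_{1,i}=0$ is allowed, which occurs exactly when $X$ is a cone). For $0\le j\le n$ put $$\sigma_j=\sum_{k=1}^n(-1)^{k+1}\sum_{i=1}^{m_k}d_{k,i}^{\,j}\qquad(\text{with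 }0^0=1).$$ Then the following hold. (1) $\sigma_0=n$ and $\sigma_1=d-1$. (2) For every integer $\delta\in[0,n-2]$, one has $\dim\Sigma=\delta$ if and only if $\sigma_j=(-1)^{j+1}(d-1)^j$ for all integers $1\le j<n-\delta$ and $\sigma_{n-\delta}\ne(-1)^{n-\delta+1}(d-1)^{n-\delta}$. If this holds, then $$\deg\Sigma=\frac{1}{(n-\delta)!}\left((d-1)^{n-\delta}+(-1)^{n-\delta}\sigma_{n-\delta}\right)>0.$$ (3) $X$ is smooth if and only if, for every $k=1,\dots,n$, one has $m_k=\binom{n+1}{k+1}$ and $d_{k,1}=\dots=d_{k,m_k}=k(d-1)$. -/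

import Mathlib

namespace JacobianHypersurface

attribute [local instance] MvPolynomial.gradedAlgebra

/-- The polynomial ring `S = ℂ[x₀, …, xₙ]`. -/
abbrev PolyRing (n : ℕ) : Type := MvPolynomial (Fin (n + 1)) ℂ

/-- The Jacobian ideal `J_f`, spanned by the partial derivatives of `f`. -/
noncomputable def jacobianIdeal {n : ℕ} (f : PolyRing n) : Ideal (PolyRing n) :=
  Ideal.span (Set.range fun i : Fin (n + 1) => MvPolynomial.pderiv i f)

/-- The Jacobian algebra `M(f) = S / J_f`. -/
abbrev JacobianAlgebra {n : ℕ} (f : PolyRing n) : Type := PolyRing n ⧸ jacobianIdeal f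

/-- The graded piece `M(f)_k`: the image in `M(f)` of the space of forms of degree `k`. -/
noncomputable def jacobianAlgebraPart {n : ℕ} (f : PolyRing n) (k : ℕ) :
    Submodule ℂ (JacobianAlgebra f) :=
  (MvPolynomial.homogeneousSubmodule (Fin (n + 1)) ℂ k).map
    (Ideal.Quotient.mkₐ ℂ (jacobianIdeal f)).toLinearMap

/-- `P` is the Hilbert polynomial of `M(f)`: `dim M(f)_k = P(k)` for all large `k`. -/
def IsHilbertPolynomial {n : ℕ} (f : PolyRing n) (P : Polynomial ℚ) : Prop :=
  ∃ k₀ : ℕ, ∀ k : ℕ, k₀ ≤ k →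
    (Module.finrank ℂ (jacobianAlgebraPart f k) : ℚ) = P.eval (k : ℚ)

/-- The support of the singular subscheme `Σ` of `X : f = 0`, as a closed subset of
`ℙⁿ = Proj S`. -/
def singularLocus {n : ℕ} (f : PolyRing n) :
    Set (ProjectiveSpectrum (MvPolynomial.homogeneousSubmodule (Fin (n + 1)) ℂ)) :=
  ProjectiveSpectrum.zeroLocus (MvPolynomial.homogeneousSubmodule (Fin (n + 1)) ℂ)
    (jacobianIdeal f : Set (PolyRing n))

/-- The dimension of `Σ`, that is, the Krull dimension of its underlying topological space
(`⊥` if `Σ` is empty). -/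
noncomputable def singularDim {n : ℕ} (f : PolyRing n) : WithBot ℕ∞ :=
  topologicalKrullDim (singularLocus f)

/-- `e` is the degree of `Σ` as a subscheme of `ℙⁿ`: with `r = dim Σ`, the leading term of the
Hilbert polynomial of `M(f)` is `(e / r!) u ^ r`. -/
def HasSingularDegree {n : ℕ} (f : PolyRing n) (e : ℚ) : Prop :=
  ∃ P : Polynomial ℚ, IsHilbertPolynomial f P ∧ singularDim f = (P.natDegree : WithBot ℕ∞) ∧
    P.leadingCoeff = e / (P.natDegree.factorial : ℚ)

/-- The hypersurface `X : f = 0` in `ℙⁿ` is smooth: at every point of `X` some partial derivative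
of `f` does not vanish. -/
def IsSmoothHypersurface {n : ℕ} (f : PolyRing n) : Prop :=
  ∀ x : Fin (n + 1) → ℂ, x ≠ 0 → MvPolynomial.eval x f = 0 →
    ∃ i, MvPolynomial.eval x (MvPolynomial.pderiv i f) ≠ 0

/-- The set of homogeneous elements of degree `t` in the graded free module `⊕ᵢ S(-aᵢ)`:
the `i`-th coordinate is a form of degree `t - aᵢ` (and is zero if `t < aᵢ`). -/
def IsHomogeneousVector {n m : ℕ} (a : Fin m → ℕ) (t : ℕ) (v : Fin m → PolyRing n) : Prop :=
  ∀ i, (a i ≤ t → (v i).IsHomogeneous (t - a i)) ∧ (t < a i → v i = 0)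

/-- A minimal graded free resolution
`0 → E_n → ⋯ → E_1 → E_0 = S^{n+1}(1-d) → S` of the Jacobian algebra `M(f)`, where the last map is
given by the partial derivatives of `f` (so that its cokernel is `M(f)`), and where
`E_k = ⊕_i S(1 - d - d_{k,i})`, `1 ≤ i ≤ m_k`.

Minimality is the condition that, for all `k ≥ 1`, the matrix of `E_{k+1} → E_k` has its entries
in the maximal ideal `(x₀, …, xₙ)`. In other words `E_n → ⋯ → E_1` is a minimal free resolution of
the module of syzygies of the partial derivatives. Nothing is asked of `E_1 → E_0`: its entries lie
in the maximal ideal if and only if the partial derivatives are linearly independent, and if they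
are not (that is, if `X` is a cone) then some `d_{1,i}` are equal to `0`. -/
structure MinimalResolution {n : ℕ} (d : ℕ) (f : PolyRing n) where
  /-- the rank `m_k` of `E_k` -/
  m : ℕ → ℕ
  /-- the integers `d_{k,i}` -/
  deg : (k : ℕ) → Fin (m k) → ℕ
  /-- the differential `E_{k+1} → E_k` -/
  diff : (k : ℕ) → (Fin (m (k + 1)) → PolyRing n) →ₗ[PolyRing n] (Fin (m k) → PolyRing n)
  rank_zero : m 0 = n + 1
  deg_zero : ∀ i, deg 0 i = 0
  /-- the resolution ends with `E_n` -/
  rank_eq_zero : ∀ k, n < k → m k = 0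
  /-- the differentials are homogeneous of degree `0` -/
  diff_homogeneous : ∀ (k t : ℕ) (v : Fin (m (k + 1)) → PolyRing n),
    IsHomogeneousVector (fun i => d - 1 + deg (k + 1) i) t v →
      IsHomogeneousVector (fun i => d - 1 + deg k i) t (diff k v)
  /-- exactness at `E_{k+1}` -/
  exact : ∀ k, Function.Exact (diff (k + 1)) (diff k)
  /-- exactness at `E_0 = S^{n+1}(1-d)` -/
  exact_zero : Function.Exact (diff 0)
    (fun v : Fin (m 0) → PolyRing n =>
      ∑ i, v i * MvPolynomial.pderiv (Fin.cast rank_zero i) f)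
  minimal : ∀ k, 1 ≤ k → ∀ (v : Fin (m (k + 1)) → PolyRing n) (i : Fin (m k)),
    MvPolynomial.constantCoeff (diff k v i) = 0

/-- The alternating power sum `σ_j = ∑_{k=1}^n (-1)^{k+1} ∑_i d_{k,i}^j` (with `0 ^ 0 = 1`). -/
def MinimalResolution.sigma {n d : ℕ} {f : PolyRing n} (R : MinimalResolution d f) (j : ℕ) : ℤ :=
  ∑ k ∈ Finset.Icc 1 n, (-1) ^ (k + 1) * ∑ i : Fin (R.m k), (R.deg k i : ℤ) ^ j

end JacobianHypersurface

/-! The resolution gives the Hilbert series of `M(f)` as `N(t) / (1 - t)^(n+1)`, where `N = 1 -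
(n+1) t^(d-1) + ∑ (-1)^(k+1) t^(d-1+d_{k,i})`. Write `N = (1 - t)^c q` with `q(1) ≠ 0`. Give `t^a`
the weight `(a - (d-1))^j`. The resulting `j`-th moment of `N` is `(-(d-1))^j - (n+1) 0^j + σ_j`. It
vanishes for `j < c`, and for `j = c` it equals `(-1)^c c! q(1)` (`moment_one_sub_X_pow_mul`). So
the numbers `σ_j` detect both `c` and `q(1)`.

Geometrically, `dim Σ = n - c` when `c ≤ n`, and then `deg Σ = q(1)`. The link between topological
dimension and Hilbert function is `krullDim_zeroLocus_lt_iff`: the zero locus of `I` has dimension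
`< s` exactly when `∑_{t ≤ T} dim (S/I)_t = O(T^s)`. Chains of homogeneous primes give the lower
bound on growth, Noetherian induction on homogeneous ideals the upper bound. Since `f` is
squarefree, `Σ` has codimension at least two (`growthLE_jacobianIdeal`), hence `c ≥ 2`, which is
(1). Then (2) says that `c = n - δ` is the order of the first nonzero moment, and positivity of the
degree comes from nonnegativity of the Hilbert function.

For (3), the Koszul numerics give `N = (1 - t^(d-1))^(n+1)`, hence `c = n + 1`, `M(f)` vanishes in
some degree, and the partials have no common zero. Conversely, if `X` is smooth, the Nullstellensatz
puts powers of all variables in `J_f`. These form a regular sequence of length `n + 1`, so the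
Koszul complex of the partials is exact in positive degrees. It is minimal, and uniqueness of
minimal graded resolutions (`exists_equiv_koszul`) forces the ranks and degrees. -/

namespace JacobianHypersurface

attribute [local instance] MvPolynomial.gradedAlgebra

/-! ### Hilbert functions of homogeneous ideals, colon ideals and added generators. -/

section HilbertFunction

open MvPolynomial

variable {σ K : Type*} [Field K]

lemma coe_decompose_eq (p : MvPolynomial σ K) (t : ℕ) :
    (DirectSum.decompose (homogeneousSubmodule σ K) p t : MvPolynomial σ K) =
      homogeneousComponent t p :=
  decomposition.decompose'_apply p t

lemma homogeneousComponent_mul_add {g : MvPolynomial σ K} {e : ℕ} (hg : g.IsHomogeneous e)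
    (p : MvPolynomial σ K) (t : ℕ) :
    homogeneousComponent (t + e) (p * g) = homogeneousComponent t p * g := by
  rw [← coe_decompose_eq, ← coe_decompose_eq]
  exact DirectSum.coe_decompose_mul_add_of_right_mem _ hg

lemma homogeneousComponent_mul_of_lt {g : MvPolynomial σ K} {e : ℕ} (hg : g.IsHomogeneous e)
    (p : MvPolynomial σ K) {t : ℕ} (ht : t < e) :
    homogeneousComponent t (p * g) = 0 := by
  rw [← coe_decompose_eq]
  exact DirectSum.coe_decompose_mul_of_right_mem_of_not_le _ hg (by omega)

/-- The ideal of all `p` with `g * p ∈ I`. -/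
noncomputable def colonBy (I : Ideal (MvPolynomial σ K)) (g : MvPolynomial σ K) : Ideal (MvPolynomial σ K) :=
  Submodule.comap (LinearMap.mulLeft (MvPolynomial σ K) g) I

lemma mem_colonBy {I : Ideal (MvPolynomial σ K)} {g p : MvPolynomial σ K} :
    p ∈ colonBy I g ↔ g * p ∈ I := Iff.rfl

lemma le_colonBy (I : Ideal (MvPolynomial σ K)) (g : MvPolynomial σ K) : I ≤ colonBy I g :=
  fun _ hp => I.mul_mem_left _ hp

lemma isHomogeneous_of_components {I : Ideal (MvPolynomial σ K)}
    (h : ∀ p ∈ I, ∀ t, homogeneousComponent t p ∈ I) :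
    I.IsHomogeneous (homogeneousSubmodule σ K) := by
  intro t p hp
  rw [coe_decompose_eq]
  exact h p hp t

lemma colonBy_isHomogeneous {I : Ideal (MvPolynomial σ K)}
    (hI : I.IsHomogeneous (homogeneousSubmodule σ K)) {g : MvPolynomial σ K} {e : ℕ}
    (hg : g.IsHomogeneous e) : (colonBy I g).IsHomogeneous (homogeneousSubmodule σ K) := by
  refine isHomogeneous_of_components fun p hp t => ?_
  rw [mem_colonBy, mul_comm, ← homogeneousComponent_mul_add hg, mul_comm]
  exact homogeneousComponent_mem_of_mem hI hp _

lemma sup_span_singleton_isHomogeneous {I : Ideal (MvPolynomial σ K)}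
    (hI : I.IsHomogeneous (homogeneousSubmodule σ K)) {g : MvPolynomial σ K} {e : ℕ}
    (hg : g.IsHomogeneous e) :
    (I ⊔ Ideal.span {g}).IsHomogeneous (homogeneousSubmodule σ K) :=
  hI.sup (Ideal.homogeneous_span _ _ fun x hx => by
    rw [Set.mem_singleton_iff.1 hx]; exact ⟨e, hg⟩)

/-- The degree `t` part of `S ⧸ I`. -/
noncomputable def gradedPart (I : Ideal (MvPolynomial σ K)) (t : ℕ) :
    Submodule K (MvPolynomial σ K ⧸ I) :=
  (homogeneousSubmodule σ K t).map (Ideal.Quotient.mkₐ K I).toLinearMap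

/-- The Hilbert function of `S ⧸ I`. -/
noncomputable def hilb (I : Ideal (MvPolynomial σ K)) (t : ℕ) : ℕ :=
  Module.finrank K (gradedPart I t)

lemma mk_mem_gradedPart {I : Ideal (MvPolynomial σ K)} {p : MvPolynomial σ K} {t : ℕ}
    (hp : p.IsHomogeneous t) : Ideal.Quotient.mk I p ∈ gradedPart I t :=
  ⟨p, hp, rfl⟩

lemma mem_sup_span_singleton_add {I : Ideal (MvPolynomial σ K)}
    (hI : I.IsHomogeneous (homogeneousSubmodule σ K)) {g p : MvPolynomial σ K} {e t : ℕ}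
    (hg : g.IsHomogeneous e) (hp : p.IsHomogeneous (t + e)) :
    p ∈ I ⊔ Ideal.span {g} ↔ ∃ r : MvPolynomial σ K, r.IsHomogeneous t ∧ p - r * g ∈ I := by
  constructor
  · intro h
    obtain ⟨i, hi, x, hx, rfl⟩ := Submodule.mem_sup.1 h
    obtain ⟨r, rfl⟩ := Ideal.mem_span_singleton'.1 hx
    refine ⟨homogeneousComponent t r, homogeneousComponent_isHomogeneous _ _, ?_⟩
    have h1 : homogeneousComponent (t + e) (i + r * g) = i + r * g :=
      homogeneousComponent_eq_self hp
    rw [map_add, homogeneousComponent_mul_add hg] at h1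
    rw [← h1, add_sub_cancel_right]
    exact homogeneousComponent_mem_of_mem hI hi _
  · rintro ⟨r, -, h⟩
    rw [← sub_add_cancel p (r * g)]
    exact add_mem (Ideal.mem_sup_left h)
      (Ideal.mem_sup_right (Ideal.mul_mem_left _ _ (Ideal.mem_span_singleton_self g)))

lemma mem_sup_span_singleton_of_lt {I : Ideal (MvPolynomial σ K)}
    (hI : I.IsHomogeneous (homogeneousSubmodule σ K)) {g p : MvPolynomial σ K} {e t : ℕ}
    (hg : g.IsHomogeneous e) (ht : t < e) (hp : p.IsHomogeneous t) :
    p ∈ I ⊔ Ideal.span {g} ↔ p ∈ I := by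
  refine ⟨fun h => ?_, fun h => Ideal.mem_sup_left h⟩
  obtain ⟨i, hi, x, hx, rfl⟩ := Submodule.mem_sup.1 h
  obtain ⟨r, rfl⟩ := Ideal.mem_span_singleton'.1 hx
  have h1 : homogeneousComponent t (i + r * g) = i + r * g :=
    homogeneousComponent_eq_self hp
  rw [map_add, homogeneousComponent_mul_of_lt hg _ ht, add_zero] at h1
  rw [← h1]
  exact homogeneousComponent_mem_of_mem hI hi _

lemma finrank_range_eq_of_ker_eq {V W W' : Type*} [AddCommGroup V] [Module K V]
    [AddCommGroup W] [Module K W] [AddCommGroup W'] [Module K W'] [Module.Finite K V]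
    (φ : V →ₗ[K] W) (ψ : V →ₗ[K] W') (h : LinearMap.ker φ = LinearMap.ker ψ) :
    Module.finrank K (LinearMap.range φ) = Module.finrank K (LinearMap.range ψ) := by
  have h1 := φ.finrank_range_add_finrank_ker
  have h2 := ψ.finrank_range_add_finrank_ker
  rw [h] at h1
  omega

lemma finrank_map_add_finrank_ker {V W : Type*} [AddCommGroup V] [Module K V]
    [AddCommGroup W] [Module K W] [Module.Finite K V] (φ : V →ₗ[K] W) (p : Submodule K V)
    (h : LinearMap.ker φ ≤ p) :
    Module.finrank K (p.map φ) + Module.finrank K (LinearMap.ker φ) = Module.finrank K p := by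
  have h1 := (φ ∘ₗ p.subtype).finrank_range_add_finrank_ker
  rw [LinearMap.range_comp, Submodule.range_subtype, LinearMap.ker_comp,
    (Submodule.comapSubtypeEquivOfLe h).finrank_eq] at h1
  exact h1

/-- The map `S_t → S ⧸ I`. -/
noncomputable def partMk (I : Ideal (MvPolynomial σ K)) (t : ℕ) :
    homogeneousSubmodule σ K t →ₗ[K] MvPolynomial σ K ⧸ I :=
  (Ideal.Quotient.mkₐ K I).toLinearMap ∘ₗ (homogeneousSubmodule σ K t).subtype

lemma range_partMk (I : Ideal (MvPolynomial σ K)) (t : ℕ) :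
    LinearMap.range (partMk I t) = gradedPart I t := by
  rw [partMk, LinearMap.range_comp, Submodule.range_subtype, gradedPart]

lemma mem_ker_partMk {I : Ideal (MvPolynomial σ K)} {t : ℕ}
    {p : homogeneousSubmodule σ K t} : p ∈ LinearMap.ker (partMk I t) ↔ (p : MvPolynomial σ K) ∈ I := by
  rw [LinearMap.mem_ker]
  exact Ideal.Quotient.eq_zero_iff_mem

variable [Finite σ]

instance (t : ℕ) : Module.Finite K (homogeneousSubmodule σ K t) :=
  Module.Finite.iff_fg.2 (homogeneousSubmodule_fg σ K t)

instance (I : Ideal (MvPolynomial σ K)) (t : ℕ) : Module.Finite K (gradedPart I t) := by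
  unfold gradedPart; infer_instance

lemma hilb_eq_of_forall {I J : Ideal (MvPolynomial σ K)} {t : ℕ}
    (h : ∀ p : MvPolynomial σ K, p.IsHomogeneous t → (p ∈ I ↔ p ∈ J)) : hilb I t = hilb J t := by
  rw [hilb, hilb, ← range_partMk, ← range_partMk]
  refine finrank_range_eq_of_ker_eq _ _ ?_
  ext p
  rw [mem_ker_partMk, mem_ker_partMk]
  exact h p p.2

lemma hilb_antitone {I J : Ideal (MvPolynomial σ K)} (h : I ≤ J) (t : ℕ) : hilb J t ≤ hilb I t := by
  have h1 := (partMk I t).finrank_range_add_finrank_ker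
  have h2 := (partMk J t).finrank_range_add_finrank_ker
  have h3 : Module.finrank K (LinearMap.ker (partMk I t)) ≤
      Module.finrank K (LinearMap.ker (partMk J t)) := by
    refine Submodule.finrank_mono fun p hp => ?_
    rw [mem_ker_partMk] at hp ⊢
    exact h hp
  rw [hilb, hilb, ← range_partMk, ← range_partMk]
  omega

lemma hilb_sup_span_singleton_of_lt {I : Ideal (MvPolynomial σ K)}
    (hI : I.IsHomogeneous (homogeneousSubmodule σ K)) {g : MvPolynomial σ K} {e t : ℕ}
    (hg : g.IsHomogeneous e) (ht : t < e) : hilb (I ⊔ Ideal.span {g}) t = hilb I t :=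
  hilb_eq_of_forall fun _ hp => mem_sup_span_singleton_of_lt hI hg ht hp

/-- Dimension count in the exact sequence `0 → (S/(I : g))(-e) → S/I → S/(I + (g)) → 0`, where the
first map is multiplication by `g`. -/
lemma hilb_add {I : Ideal (MvPolynomial σ K)}
    (hI : I.IsHomogeneous (homogeneousSubmodule σ K)) {g : MvPolynomial σ K} {e : ℕ}
    (hg : g.IsHomogeneous e) (t : ℕ) :
    hilb I (t + e) = hilb (colonBy I g) t + hilb (I ⊔ Ideal.span {g}) (t + e) := by
  let mulG : homogeneousSubmodule σ K t →ₗ[K] homogeneousSubmodule σ K (t + e) :=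
    { toFun := fun p => ⟨p * g, (p.2 : (p : MvPolynomial σ K).IsHomogeneous t).mul hg⟩
      map_add' := fun p q => Subtype.ext (add_mul _ _ _)
      map_smul' := fun c p => Subtype.ext (smul_mul_assoc _ _ _) }
  have h1 := (partMk I (t + e)).finrank_range_add_finrank_ker
  have h2 := (partMk (I ⊔ Ideal.span {g}) (t + e)).finrank_range_add_finrank_ker
  have h3 : hilb (colonBy I g) t = Module.finrank K (LinearMap.range (partMk I (t + e) ∘ₗ mulG)) := by
    rw [hilb, ← range_partMk]
    refine finrank_range_eq_of_ker_eq _ _ ?_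
    ext p
    rw [mem_ker_partMk, mem_colonBy, mul_comm]
    exact (Ideal.Quotient.eq_zero_iff_mem (I := I)).symm
  have h4 : LinearMap.range (partMk I (t + e) ∘ₗ mulG) =
      (LinearMap.ker (partMk (I ⊔ Ideal.span {g}) (t + e))).map (partMk I (t + e)) := by
    ext y
    constructor
    · rintro ⟨p, rfl⟩
      refine ⟨mulG p, mem_ker_partMk.2 (Ideal.mem_sup_right ?_), rfl⟩
      exact Ideal.mul_mem_left _ _ (Ideal.mem_span_singleton_self g)
    · rintro ⟨q, hq, rfl⟩
      rw [SetLike.mem_coe, mem_ker_partMk, mem_sup_span_singleton_add hI hg q.2] at hq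
      obtain ⟨r, hr, hqr⟩ := hq
      exact ⟨⟨r, hr⟩, (Ideal.Quotient.eq.2 hqr).symm⟩
  have h5 := finrank_map_add_finrank_ker (partMk I (t + e))
    (LinearMap.ker (partMk (I ⊔ Ideal.span {g}) (t + e))) fun p hp => by
      rw [mem_ker_partMk] at hp ⊢
      exact Ideal.mem_sup_left hp
  rw [h3, h4]
  rw [hilb, hilb, ← range_partMk, ← range_partMk]
  omega

end HilbertFunction

/-! ### Growth of the cumulative Hilbert function versus chains of homogeneous primes. -/

section Growth

open MvPolynomial

variable {σ K : Type*} [Field K]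

/-- The cumulative Hilbert function `∑_{t ≤ T} dim (S ⧸ I)_t`. -/
noncomputable def cumHilb (I : Ideal (MvPolynomial σ K)) (T : ℕ) : ℕ :=
  ∑ t ∈ Finset.range (T + 1), hilb I t

lemma cumHilb_succ (I : Ideal (MvPolynomial σ K)) (T : ℕ) :
    cumHilb I (T + 1) = cumHilb I T + hilb I (T + 1) :=
  Finset.sum_range_succ _ _

lemma cumHilb_mono (I : Ideal (MvPolynomial σ K)) : Monotone (cumHilb I) :=
  monotone_nat_of_le_succ fun T => by rw [cumHilb_succ]; omega

/-- `∑_{t ≤ T} dim (S ⧸ I)_t = O(T ^ s)`. -/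
def GrowthLE (I : Ideal (MvPolynomial σ K)) (s : ℕ) : Prop :=
  ∃ C : ℕ, ∀ T, cumHilb I T ≤ C * (T + 1) ^ s

/-- `T ^ s = O(∑_{t ≤ T} dim (S ⧸ I)_t)`. -/
def GrowthGE (I : Ideal (MvPolynomial σ K)) (s : ℕ) : Prop :=
  ∃ c : ℕ, ∀ T, T ^ s ≤ c * cumHilb I T

lemma GrowthLE.mono {I : Ideal (MvPolynomial σ K)} {s s' : ℕ} (h : GrowthLE I s) (hs : s ≤ s') :
    GrowthLE I s' := by
  obtain ⟨C, hC⟩ := h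
  exact ⟨C, fun T => (hC T).trans (Nat.mul_le_mul_left _ (Nat.pow_le_pow_right (by omega) hs))⟩

/-- Discrete integration: if the increments of `F` over steps of length `e` dominate `E`, then `F`
grows one order faster than `E`. -/
lemma exists_pow_succ_le {F E : ℕ → ℕ} {e s c : ℕ} (hF : Monotone F) (hE : Monotone E)
    (he : 0 < e) (h1 : 1 ≤ F 0) (h : ∀ T, F T + E T ≤ F (T + e)) (hc : ∀ T, T ^ s ≤ c * E T) :
    ∃ c', ∀ T, T ^ (s + 1) ≤ c' * F T := by
  have h2 : ∀ A L, L * E A ≤ F (A + L * e) := by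
    intro A L
    induction L with
    | zero => simp
    | succ L ih =>
      have h3 := h (A + L * e)
      have h4 := hE (Nat.le_add_right A (L * e))
      calc (L + 1) * E A = L * E A + E A := by ring
        _ ≤ F (A + L * e) + E (A + L * e) := by omega
        _ ≤ F (A + L * e + e) := h3
        _ = F (A + (L + 1) * e) := by congr 1; ring
  -- With `L = ⌊T / 2e⌋`, half of `[0, T]` is used to make `E` large and the other half to make `L`
  -- steps: `F T ≥ L * E (L * e)`. If `L ≥ 1` then `T ≤ 4eL`; if `L = 0` the constant absorbs
  -- everything because `F T ≥ 1`.
  refine ⟨(4 * e) ^ (s + 1) * (c + 1), fun T => ?_⟩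
  have hFT : 1 ≤ F T := h1.trans (hF (Nat.zero_le T))
  obtain ⟨L, hL1, hL2⟩ : ∃ L, 2 * e * L ≤ T ∧ T < 2 * e * (L + 1) :=
    ⟨T / (2 * e), Nat.mul_div_le T (2 * e), Nat.lt_mul_div_succ T (by omega)⟩
  rcases Nat.eq_zero_or_pos L with rfl | hL
  · have : T ≤ 4 * e := by omega
    calc T ^ (s + 1) ≤ (4 * e) ^ (s + 1) := Nat.pow_le_pow_left this _
      _ = (4 * e) ^ (s + 1) * 1 * 1 := by ring
      _ ≤ (4 * e) ^ (s + 1) * (c + 1) * F T := by gcongr; omega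
  · have h3 : T ≤ 4 * e * L := by nlinarith
    have h4 : c * (L * E (L * e)) ≤ c * F T :=
      Nat.mul_le_mul_left _ ((h2 (L * e) L).trans (hF (by nlinarith)))
    have h5 : L ^ s ≤ (L * e) ^ s := Nat.pow_le_pow_left (Nat.le_mul_of_pos_right _ he) _
    calc T ^ (s + 1) ≤ (4 * e * L) ^ (s + 1) := Nat.pow_le_pow_left h3 _
      _ = (4 * e) ^ (s + 1) * (L * L ^ s) := by ring
      _ ≤ (4 * e) ^ (s + 1) * (L * (c * E (L * e))) := by
          gcongr; exact h5.trans (hc _)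
      _ = (4 * e) ^ (s + 1) * (c * (L * E (L * e))) := by ring
      _ ≤ (4 * e) ^ (s + 1) * (c * F T) := by gcongr
      _ ≤ (4 * e) ^ (s + 1) * (c + 1) * F T := by
          rw [mul_assoc]; gcongr; omega

lemma le_of_forall_pow_le {s s' c C : ℕ} {F : ℕ → ℕ} (h : ∀ T, T ^ s ≤ c * F T)
    (h' : ∀ T, F T ≤ C * (T + 1) ^ s') : s ≤ s' := by
  by_contra! hs
  obtain ⟨k, rfl⟩ := Nat.exists_eq_add_of_lt hs
  set A := c * C * 2 ^ s' with hA
  have h1 : (A + 1) ^ (s' + k + 1) ≤ A * (A + 1) ^ s' := by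
    calc (A + 1) ^ (s' + k + 1) ≤ c * (C * (A + 1 + 1) ^ s') :=
          (h _).trans (Nat.mul_le_mul_left _ (h' _))
      _ ≤ c * (C * (2 * (A + 1)) ^ s') := by gcongr; omega
      _ = A * (A + 1) ^ s' := by rw [mul_pow, hA]; ring
  have h2 : (A + 1) ^ (s' + 1) ≤ (A + 1) ^ (s' + k + 1) :=
    Nat.pow_le_pow_right (by omega) (by omega)
  have h3 : 0 < (A + 1) ^ s' := by positivity
  rw [pow_succ] at h2
  nlinarith

variable [Finite σ]

lemma cumHilb_antitone {I J : Ideal (MvPolynomial σ K)} (h : I ≤ J) (T : ℕ) :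
    cumHilb J T ≤ cumHilb I T :=
  Finset.sum_le_sum fun t _ => hilb_antitone h t

lemma cumHilb_add {I : Ideal (MvPolynomial σ K)}
    (hI : I.IsHomogeneous (homogeneousSubmodule σ K)) {g : MvPolynomial σ K} {e : ℕ}
    (hg : g.IsHomogeneous e) (T : ℕ) :
    cumHilb I (T + e) = cumHilb (colonBy I g) T + cumHilb (I ⊔ Ideal.span {g}) (T + e) := by
  induction T with
  | zero =>
    have h := hilb_add hI hg 0
    have h' : ∑ t ∈ Finset.range e, hilb I t =
        ∑ t ∈ Finset.range e, hilb (I ⊔ Ideal.span {g}) t := Finset.sum_congr rfl fun t ht =>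
      (hilb_sup_span_singleton_of_lt hI hg (Finset.mem_range.1 ht)).symm
    rw [zero_add] at h ⊢
    rw [cumHilb, cumHilb, cumHilb, Finset.sum_range_succ, Finset.sum_range_succ _ e,
      Finset.sum_range_one, h', h]
    omega
  | succ T ih =>
    have h := hilb_add hI hg (T + 1)
    rw [Nat.add_right_comm] at h ⊢
    rw [cumHilb_succ, cumHilb_succ, cumHilb_succ, ih, h]
    omega

lemma hilb_pos {I : Ideal (MvPolynomial σ K)} {p : MvPolynomial σ K} {t : ℕ}
    (hp : p.IsHomogeneous t) (h : p ∉ I) : 0 < hilb I t := by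
  rw [hilb, Module.finrank_pos_iff]
  refine ⟨⟨⟨_, mk_mem_gradedPart hp⟩, 0, fun h0 => h ?_⟩⟩
  exact Ideal.Quotient.eq_zero_iff_mem.1 (congrArg Subtype.val h0)

lemma mem_of_hilb_eq_zero {I : Ideal (MvPolynomial σ K)} {t : ℕ} (h : hilb I t = 0)
    {p : MvPolynomial σ K} (hp : p.IsHomogeneous t) : p ∈ I := by
  by_contra hp'
  exact (hilb_pos hp hp').ne' h

omit [Finite σ] in
lemma hilb_eq_zero {I : Ideal (MvPolynomial σ K)} {t : ℕ}
    (h : ∀ p : MvPolynomial σ K, p.IsHomogeneous t → p ∈ I) : hilb I t = 0 := by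
  have : gradedPart I t = ⊥ := by
    rw [eq_bot_iff]
    rintro _ ⟨p, hp, rfl⟩
    exact Ideal.Quotient.eq_zero_iff_mem.2 (h p hp)
  rw [hilb, this, finrank_bot]

lemma one_le_cumHilb {I : Ideal (MvPolynomial σ K)} (h : I ≠ ⊤) (T : ℕ) : 1 ≤ cumHilb I T := by
  have h0 : 0 < hilb I 0 := hilb_pos (isHomogeneous_one σ K) fun h1 => h ((Ideal.eq_top_iff_one _).2 h1)
  calc 1 ≤ cumHilb I 0 := Nat.succ_le_of_lt (by simpa [cumHilb] using h0)
    _ ≤ cumHilb I T := cumHilb_mono I (Nat.zero_le T)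

lemma GrowthGE.anti {I J : Ideal (MvPolynomial σ K)} {s : ℕ} (h : GrowthGE J s) (hIJ : I ≤ J) :
    GrowthGE I s := by
  obtain ⟨c, hc⟩ := h
  exact ⟨c, fun T => (hc T).trans (Nat.mul_le_mul_left _ (cumHilb_antitone hIJ T))⟩

omit [Finite σ] in
lemma GrowthGE.le_of_growthLE {I : Ideal (MvPolynomial σ K)} {s s' : ℕ} (h : GrowthGE I s)
    (h' : GrowthLE I s') : s ≤ s' := by
  obtain ⟨c, hc⟩ := h
  obtain ⟨C, hC⟩ := h'
  exact le_of_forall_pow_le hc hC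

lemma growthGE_zero {I : Ideal (MvPolynomial σ K)} (h : I ≠ ⊤) : GrowthGE I 0 :=
  ⟨1, fun T => by simpa using one_le_cumHilb h T⟩

omit [Finite σ] in
lemma colonBy_eq_of_isPrime {P : Ideal (MvPolynomial σ K)} (hP : P.IsPrime)
    {g : MvPolynomial σ K} (hg : g ∉ P) : colonBy P g = P := by
  ext p
  rw [mem_colonBy]
  exact ⟨fun h => (hP.mem_or_mem h).resolve_left hg, fun h => P.mul_mem_left _ h⟩

/-- A form `g` outside the prime `P` is a nonzerodivisor modulo `P`, so the increments of the
cumulative function of `P` are those of `P + (g) ≤ Q`. -/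
lemma GrowthGE.succ_of_isPrime {P Q : Ideal (MvPolynomial σ K)}
    (hP : P.IsHomogeneous (homogeneousSubmodule σ K)) (hP' : P.IsPrime) {s : ℕ} (hQ : GrowthGE Q s)
    (hPQ : P ≤ Q) {g : MvPolynomial σ K} {e : ℕ} (he : 0 < e) (hg : g.IsHomogeneous e)
    (hgQ : g ∈ Q) (hgP : g ∉ P) : GrowthGE P (s + 1) := by
  obtain ⟨c, hc⟩ := hQ
  refine exists_pow_succ_le (cumHilb_mono P) (cumHilb_mono Q) he (one_le_cumHilb hP'.ne_top 0)
    (fun T => ?_) hc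
  rw [cumHilb_add hP hg, colonBy_eq_of_isPrime hP' hgP]
  gcongr
  calc cumHilb Q T ≤ cumHilb Q (T + e) := cumHilb_mono Q (by omega)
    _ ≤ _ := cumHilb_antitone (sup_le hPQ ((Ideal.span_singleton_le_iff_mem Q).2 hgQ)) _

/-- Since `I ≤ (I : g)`, passing from `T` to `T + 1` adds at most the cumulative function of `I +
(g)`; summing costs one power of `T`. Degree one of `g` makes the step equal to one. -/
lemma GrowthLE.of_sup_X {I : Ideal (MvPolynomial σ K)}
    (hI : I.IsHomogeneous (homogeneousSubmodule σ K)) {g : MvPolynomial σ K}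
    (hg : g.IsHomogeneous 1) {s : ℕ} (h : GrowthLE (I ⊔ Ideal.span {g}) s) :
    GrowthLE I (s + 1) := by
  obtain ⟨C, hC⟩ := h
  have h1 : ∀ T, cumHilb I T ≤ cumHilb I 0 + T * (C * (T + 1) ^ s) := by
    intro T
    induction T with
    | zero => simp
    | succ T ih =>
      have h2 := cumHilb_add hI hg T
      have h3 := hC (T + 1)
      have h4 := cumHilb_antitone (le_colonBy I g) T
      have h5 : T * (C * (T + 1) ^ s) ≤ T * (C * (T + 1 + 1) ^ s) := by gcongr; omega
      rw [Nat.succ_mul]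
      omega
  refine ⟨cumHilb I 0 + C, fun T => (h1 T).trans ?_⟩
  have h2 : 1 ≤ (T + 1) ^ (s + 1) := Nat.one_le_pow _ _ (by omega)
  calc cumHilb I 0 + T * (C * (T + 1) ^ s)
      ≤ cumHilb I 0 * (T + 1) ^ (s + 1) + (T + 1) * (C * (T + 1) ^ s) := by
        gcongr
        · exact Nat.le_mul_of_pos_right _ h2
        · omega
    _ = _ := by ring

lemma GrowthLE.of_colonBy_of_sup {I : Ideal (MvPolynomial σ K)}
    (hI : I.IsHomogeneous (homogeneousSubmodule σ K)) {g : MvPolynomial σ K} {e : ℕ}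
    (hg : g.IsHomogeneous e) {s : ℕ} (h : GrowthLE (colonBy I g) s)
    (h' : GrowthLE (I ⊔ Ideal.span {g}) s) : GrowthLE I s := by
  obtain ⟨C, hC⟩ := h
  obtain ⟨C', hC'⟩ := h'
  refine ⟨C + C' * (e + 1) ^ s, fun T => ?_⟩
  calc cumHilb I T ≤ cumHilb I (T + e) := cumHilb_mono I (by omega)
    _ = cumHilb (colonBy I g) T + cumHilb (I ⊔ Ideal.span {g}) (T + e) := cumHilb_add hI hg T
    _ ≤ C * (T + 1) ^ s + C' * (T + e + 1) ^ s := add_le_add (hC _) (hC' _)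
    _ ≤ C * (T + 1) ^ s + C' * ((e + 1) * (T + 1)) ^ s := by gcongr; nlinarith
    _ = _ := by rw [mul_pow]; ring

omit [Finite σ] in
lemma growthLE_of_eventually_zero {I : Ideal (MvPolynomial σ K)} {t₀ : ℕ}
    (h : ∀ t, t₀ ≤ t → hilb I t = 0) : GrowthLE I 0 := by
  refine ⟨cumHilb I t₀, fun T => ?_⟩
  rw [pow_zero, mul_one]
  induction T with
  | zero => exact cumHilb_mono I (Nat.zero_le _)
  | succ T ih =>
    by_cases hT : t₀ ≤ T + 1
    · rw [cumHilb_succ, h _ hT]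
      exact ih
    · exact cumHilb_mono I (by omega)

omit [Finite σ] in
lemma mem_of_X_mem {I : Ideal (MvPolynomial σ K)} (h : ∀ i, (X i : MvPolynomial σ K) ∈ I)
    {p : MvPolynomial σ K} (hp : constantCoeff p = 0) : p ∈ I := by
  have h1 : p ∈ Ideal.span (X '' Set.univ : Set (MvPolynomial σ K)) := by
    rw [mem_ideal_span_X_image]
    intro m hm
    by_contra! h2
    have : m = 0 := by ext i; simpa using h2 i
    subst this
    rw [mem_support_iff] at hm
    exact hm hp
  refine (Ideal.span_le.2 ?_) h1
  rintro _ ⟨i, -, rfl⟩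
  exact h i

omit [Finite σ] in
lemma IsHomogeneous.constantCoeff_eq_zero {p : MvPolynomial σ K} {t : ℕ} (hp : p.IsHomogeneous t)
    (ht : t ≠ 0) : constantCoeff p = 0 :=
  hp.coeff_eq_zero (d := 0) (by simpa using ht.symm)

omit [Finite σ] in
lemma exists_X_notMem (x : ProjectiveSpectrum (homogeneousSubmodule σ K)) :
    ∃ i, (X i : MvPolynomial σ K) ∉ x.asHomogeneousIdeal.toIdeal := by
  by_contra! h
  refine x.not_irrelevant_le fun p hp => ?_
  rw [HomogeneousIdeal.mem_irrelevant_iff] at hp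
  have h1 := coe_decompose_eq p 0
  rw [← GradedRing.proj_apply, hp, homogeneousComponent_zero] at h1
  refine mem_of_X_mem h ?_
  exact C_injective _ _ (by rw [map_zero]; exact h1.symm)

/-- A homogeneous prime ideal missing a variable, as a point of `Proj S`. -/
def projPoint {P : Ideal (MvPolynomial σ K)} (hP : P.IsHomogeneous (homogeneousSubmodule σ K))
    (hP' : P.IsPrime) {i : σ} (hi : X i ∉ P) : ProjectiveSpectrum (homogeneousSubmodule σ K) where
  asHomogeneousIdeal := ⟨P, hP⟩
  isPrime := hP'
  not_irrelevant_le h :=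
    hi (h (HomogeneousIdeal.mem_irrelevant_of_mem _ one_pos (isHomogeneous_X K i)))

/-- Each strict inclusion of the chain contributes one power of `T`. The extra `+ 1` comes from
cutting the top prime by a variable outside it, which still leaves a proper ideal. -/
lemma growthGE_of_ltSeries (k : ℕ) (p : LTSeries (ProjectiveSpectrum (homogeneousSubmodule σ K)))
    (hp : p.length = k) : GrowthGE p.head.asHomogeneousIdeal.toIdeal (k + 1) := by
  induction k generalizing p with
  | zero =>
    obtain ⟨i, hi⟩ := exists_X_notMem p.head
    have hPr := p.head.isPrime
    refine GrowthGE.succ_of_isPrime (Q := p.head.asHomogeneousIdeal.toIdeal ⊔ Ideal.span {X i})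
      p.head.asHomogeneousIdeal.isHomogeneous hPr (growthGE_zero ?_) le_sup_left one_pos
      (isHomogeneous_X K i) (Ideal.mem_sup_right (Ideal.mem_span_singleton_self _)) hi
    intro htop
    have h1 : (1 : MvPolynomial σ K) ∈
        p.head.asHomogeneousIdeal.toIdeal ⊔ Ideal.span {X i} := htop ▸ Submodule.mem_top
    rw [mem_sup_span_singleton_of_lt p.head.asHomogeneousIdeal.isHomogeneous
      (isHomogeneous_X K i) one_pos (isHomogeneous_one σ K)] at h1
    exact hPr.ne_top ((Ideal.eq_top_iff_one _).2 h1)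
  | succ k ih =>
    have h0 : p.length ≠ 0 := by omega
    have h1 := ih (p.tail h0) (by simp [hp])
    have h2 : p.head < (p.tail h0).head := by
      rw [RelSeries.head_tail]
      refine p.strictMono (Fin.lt_def.2 ?_)
      rw [Fin.val_one', Nat.mod_eq_of_lt (by omega)]
      exact Nat.zero_lt_one
    rw [← ProjectiveSpectrum.as_ideal_lt_as_ideal] at h2
    obtain ⟨g, hg1, hg2⟩ := SetLike.exists_of_lt h2
    obtain ⟨e, he⟩ : ∃ e, homogeneousComponent e g ∉ p.head.asHomogeneousIdeal.toIdeal := by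
      by_contra! h
      exact hg2 ((mem_iff_homogeneousComponent_mem p.head.asHomogeneousIdeal.isHomogeneous g).2 h)
    have hgQ : homogeneousComponent e g ∈ (p.tail h0).head.asHomogeneousIdeal.toIdeal :=
      homogeneousComponent_mem_of_mem (p.tail h0).head.asHomogeneousIdeal.isHomogeneous hg1 e
    refine GrowthGE.succ_of_isPrime p.head.asHomogeneousIdeal.isHomogeneous p.head.isPrime
      h1 h2.le (Nat.pos_of_ne_zero ?_) (homogeneousComponent_isHomogeneous e g) hgQ he
    -- A separating form of degree zero would be a nonzero constant inside a prime.
    rintro rfl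
    rw [homogeneousComponent_zero] at hgQ he
    have hc : coeff 0 g ≠ 0 := by rintro hc; simp [hc] at he
    exact (p.tail h0).head.isPrime.ne_top
      (Ideal.eq_top_of_isUnit_mem _ hgQ ((isUnit_iff_ne_zero.2 hc).map C))

lemma growthGE_of_le_head {I : Ideal (MvPolynomial σ K)}
    (p : LTSeries (ProjectiveSpectrum (homogeneousSubmodule σ K)))
    (h : I ≤ p.head.asHomogeneousIdeal.toIdeal) : GrowthGE I (p.length + 1) :=
  (growthGE_of_ltSeries _ p rfl).anti h

omit [Finite σ] in
lemma projPoint_lt {P : Ideal (MvPolynomial σ K)}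
    (hP : P.IsHomogeneous (homogeneousSubmodule σ K)) (hP' : P.IsPrime) {i : σ} (hi : X i ∉ P)
    {x : ProjectiveSpectrum (homogeneousSubmodule σ K)}
    (hx : X i ∈ x.asHomogeneousIdeal.toIdeal) (hx' : P ≤ x.asHomogeneousIdeal.toIdeal) :
    projPoint hP hP' hi < x := by
  refine lt_of_le_of_ne hx' ?_
  rintro rfl
  exact hi hx

omit [Finite σ] in
lemma mem_of_sup_span_singleton_le {I J : Ideal (MvPolynomial σ K)} {g : MvPolynomial σ K}
    (h : I ⊔ Ideal.span {g} ≤ J) : g ∈ J :=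
  h (Ideal.mem_sup_right (Ideal.mem_span_singleton_self _))

omit [Finite σ] in
lemma lt_sup_span_singleton {I : Ideal (MvPolynomial σ K)} {g : MvPolynomial σ K} (h : g ∉ I) :
    I < I ⊔ Ideal.span {g} :=
  lt_of_le_of_ne le_sup_left fun h' => h (by
    rw [h']; exact Ideal.mem_sup_right (Ideal.mem_span_singleton_self _))

omit [Finite σ] in
lemma lt_colonBy {I : Ideal (MvPolynomial σ K)} {a b : MvPolynomial σ K} (h : b ∉ I)
    (hab : a * b ∈ I) : I < colonBy I a :=
  lt_of_le_of_ne (le_colonBy I a) fun h' => h (by rw [h']; exact hab)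

/-- Noetherian induction. A prime `I` missing a variable `X i` is cut by it: any chain above `I + (X
i)` can be extended downwards by `I`, so the bound on lengths drops by one. If `I` is proper but not
prime there are forms `a, b ∉ I` with `ab ∈ I`, and both `I : a` and `I + (a)` are strictly larger
than `I`. -/
lemma growthLE_of_ltSeries {I : Ideal (MvPolynomial σ K)}
    (hI : I.IsHomogeneous (homogeneousSubmodule σ K)) {s : ℕ}
    (h : ∀ p : LTSeries (ProjectiveSpectrum (homogeneousSubmodule σ K)),
      I ≤ p.head.asHomogeneousIdeal.toIdeal → p.length < s) : GrowthLE I s := by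
  induction I using WellFoundedGT.induction generalizing s with
  | ind I ih =>
  by_cases htop : I = ⊤
  · refine (growthLE_of_eventually_zero (t₀ := 0) fun t _ => ?_).mono (Nat.zero_le s)
    exact hilb_eq_zero fun p _ => htop ▸ Submodule.mem_top
  by_cases hP : I.IsPrime
  · by_cases hX : ∀ i, (X i : MvPolynomial σ K) ∈ I
    · refine (growthLE_of_eventually_zero (t₀ := 1) fun t ht => ?_).mono (Nat.zero_le s)
      exact hilb_eq_zero fun p hp => mem_of_X_mem hX
        (IsHomogeneous.constantCoeff_eq_zero hp (by omega))
    · push Not at hX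
      obtain ⟨i, hi⟩ := hX
      have h0 := h (RelSeries.singleton _ (projPoint hI hP hi)) (by exact le_rfl)
      obtain ⟨s, rfl⟩ := Nat.exists_eq_succ_of_ne_zero (by omega : s ≠ 0)
      refine GrowthLE.of_sup_X hI (isHomogeneous_X K i) (ih _ ?_
        (sup_span_singleton_isHomogeneous hI (isHomogeneous_X K i)) fun p hp => ?_)
      · exact lt_sup_span_singleton hi
      · have hlt := projPoint_lt hI hP hi (mem_of_sup_span_singleton_le hp) (le_sup_left.trans hp)
        have := h (p.cons _ hlt) (by rw [RelSeries.head_cons]; exact le_rfl)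
        rw [RelSeries.cons_length] at this
        omega
  · have h1 := mt hI.isPrime_iff.2 hP
    push Not at h1
    obtain ⟨a, b, ⟨e, ha⟩, -, hab, ha', hb'⟩ := h1 htop
    refine GrowthLE.of_colonBy_of_sup hI (e := e) ha (ih _ ?_ (colonBy_isHomogeneous hI ha) ?_)
      (ih _ ?_ (sup_span_singleton_isHomogeneous hI ha) ?_)
    · exact lt_colonBy hb' hab
    · exact fun p hp => h p ((le_colonBy I a).trans hp)
    · exact lt_sup_span_singleton ha'
    · exact fun p hp => h p (le_sup_left.trans hp)

end Growth

/-! ### Topological dimension of projective zero loci in terms of growth. -/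

section Dimension

open MvPolynomial

variable {σ K : Type} [Field K]

instance : QuasiSober (ProjectiveSpectrum (homogeneousSubmodule σ K)) :=
  inferInstanceAs (QuasiSober (AlgebraicGeometry.Proj (homogeneousSubmodule σ K)))

instance : T0Space (ProjectiveSpectrum (homogeneousSubmodule σ K)) :=
  inferInstanceAs (T0Space (AlgebraicGeometry.Proj (homogeneousSubmodule σ K)))

/-- Soberness identifies irreducible closed subsets with their generic points. Larger closed sets
correspond to smaller primes, hence the passage through the order dual. -/
lemma topologicalKrullDim_eq_krullDim
    {Z : Set (ProjectiveSpectrum (homogeneousSubmodule σ K))} (hZ : IsClosed Z) :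
    topologicalKrullDim Z = Order.krullDim Z := by
  have : QuasiSober Z := hZ.isClosedEmbedding_subtypeVal.quasiSober
  rw [← Order.krullDim_orderDual (α := Z)]
  refine Order.krullDim_eq_of_orderIso
    ⟨irreducibleSetEquivPoints.toEquiv.trans OrderDual.toDual, fun {a b} => ?_⟩
  refine Iff.trans ?_ (irreducibleSetEquivPoints (α := Z)).map_rel_iff
  refine Iff.trans ?_ specializes_iff_mem_closure.symm
  rw [closure_subtype, Set.image_singleton, ← ProjectiveSpectrum.le_iff_mem_closure]
  rfl

lemma krullDim_zeroLocus_lt_iff_forall {I : Ideal (MvPolynomial σ K)} {s : ℕ} :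
    topologicalKrullDim (ProjectiveSpectrum.zeroLocus (homogeneousSubmodule σ K)
      (I : Set (MvPolynomial σ K))) < s ↔
      ∀ p : LTSeries (ProjectiveSpectrum (homogeneousSubmodule σ K)),
        I ≤ p.head.asHomogeneousIdeal.toIdeal → p.length < s := by
  rw [topologicalKrullDim_eq_krullDim (ProjectiveSpectrum.isClosed_zeroLocus _ _),
    Order.krullDim_lt_coe_iff]
  constructor
  · intro h p hp
    exact h ⟨p.length, fun i => ⟨p i, hp.trans (p.monotone (Fin.zero_le i))⟩, fun i => p.step i⟩
  · intro h l
    exact h ⟨l.length, fun i => (l i).1, fun i => l.step i⟩ l.head.2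

variable [Finite σ]

lemma krullDim_zeroLocus_lt_iff {I : Ideal (MvPolynomial σ K)}
    (hI : I.IsHomogeneous (homogeneousSubmodule σ K)) {s : ℕ} :
    topologicalKrullDim (ProjectiveSpectrum.zeroLocus (homogeneousSubmodule σ K)
      (I : Set (MvPolynomial σ K))) < s ↔ GrowthLE I s := by
  rw [krullDim_zeroLocus_lt_iff_forall]
  constructor
  · exact growthLE_of_ltSeries hI
  · exact fun h p hp => (growthGE_of_le_head p hp).le_of_growthLE h

lemma krullDim_zeroLocus_eq_iff {I : Ideal (MvPolynomial σ K)}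
    (hI : I.IsHomogeneous (homogeneousSubmodule σ K)) {r : ℕ} :
    topologicalKrullDim (ProjectiveSpectrum.zeroLocus (homogeneousSubmodule σ K)
      (I : Set (MvPolynomial σ K))) = (r : WithBot ℕ∞) ↔ GrowthLE I (r + 1) ∧ ¬ GrowthLE I r := by
  rw [← krullDim_zeroLocus_lt_iff hI, ← krullDim_zeroLocus_lt_iff hI, not_lt, le_antisymm_iff]
  refine and_congr_left fun _ => ?_
  generalize topologicalKrullDim (ProjectiveSpectrum.zeroLocus (homogeneousSubmodule σ K)
    (I : Set (MvPolynomial σ K))) = D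
  induction D with
  | bot => simp
  | coe D =>
    norm_cast
    exact (ENat.lt_add_one_iff (ENat.natCast_ne_top r)).symm

end Dimension

/-! ### Reducedness forces the singular locus to have codimension at least two. -/

section Reduced

open MvPolynomial

variable {σ K : Type} [Field K] [Finite σ]

lemma growthLE_bot [Fintype σ] : GrowthLE (⊥ : Ideal (MvPolynomial σ K)) (Fintype.card σ) := by
  classical
  -- Generators are removed one variable at a time, starting from the irrelevant ideal (`A` empty)
  -- and ending at `⊥` (`A` everything).
  suffices h : ∀ A : Finset σ, GrowthLE (Ideal.span (X '' (↑Aᶜ : Set σ) : Set (MvPolynomial σ K)))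
      A.card by
    simpa using h Finset.univ
  intro A
  induction A using Finset.induction_on with
  | empty =>
    refine growthLE_of_eventually_zero (t₀ := 1) fun t ht => hilb_eq_zero fun p hp =>
      mem_of_X_mem (fun i => Ideal.subset_span (Set.mem_image_of_mem _ (by simp)))
        (IsHomogeneous.constantCoeff_eq_zero hp (by omega))
  | insert i A hi ih =>
    rw [Finset.card_insert_of_notMem hi]
    refine GrowthLE.of_sup_X (Ideal.homogeneous_span _ _ ?_) (isHomogeneous_X K i) ?_
    · rintro _ ⟨j, -, rfl⟩
      exact ⟨1, isHomogeneous_X K j⟩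
    · convert ih using 1
      rw [← Ideal.span_union, ← Set.image_singleton, ← Set.image_union]
      congr 2
      ext j
      by_cases hj : j = i <;> simp [hj, hi]

omit [Finite σ] in
lemma totalDegree_pderiv_lt {p : MvPolynomial σ K} {i : σ} (h : pderiv i p ≠ 0) :
    (pderiv i p).totalDegree < p.totalDegree := by
  have h1 : ∀ m ∈ (pderiv i p).support, m.degree < p.totalDegree := by
    intro m hm
    rw [mem_support_iff, coeff_pderiv] at hm
    have h2 := le_totalDegree (mem_support_iff.2 (left_ne_zero_of_mul hm))
    change (m + Finsupp.single i 1).degree ≤ _ at h2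
    rw [map_add, Finsupp.degree_single] at h2
    omega
  obtain ⟨m, hm⟩ := support_nonempty.2 h
  rw [totalDegree, Finset.sup_lt_iff (lt_of_le_of_lt (Nat.zero_le _) (h1 m hm))]
  exact h1

omit [Finite σ] in
lemma eq_C_of_pderiv_eq_zero [CharZero K] {p : MvPolynomial σ K} (h : ∀ i, pderiv i p = 0) :
    p = C (coeff 0 p) := by
  classical
  ext m
  rw [coeff_C]
  split_ifs with hm
  · rw [hm]
  · obtain ⟨i, hi⟩ : ∃ i, m i ≠ 0 := by
      by_contra! h'
      exact hm (by ext i; simp [h' i])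
    have h1 : coeff (m - Finsupp.single i 1) (pderiv i p) = 0 := by rw [h i, coeff_zero]
    rw [coeff_pderiv, tsub_add_cancel_of_le (by simpa using Nat.one_le_iff_ne_zero.2 hi)] at h1
    exact (mul_eq_zero.1 h1).resolve_right (Nat.cast_add_one_ne_zero _)

omit [Finite σ] in
-- With `f = p q` and `p ∤ q`, divisibility of all `∂ᵢ f` by `p` gives `p ∣ ∂ᵢ p`. By degree all `∂ᵢ
-- p` vanish, so `p` is constant in characteristic zero.
lemma not_dvd_pderiv_of_squarefree [CharZero K] {p f : MvPolynomial σ K} (hf : Squarefree f)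
    (hp : Irreducible p) (hpf : p ∣ f) : ∃ i, ¬ p ∣ pderiv i f := by
  by_contra! h
  obtain ⟨q, rfl⟩ := hpf
  have hpq : ¬ p ∣ q := by
    rintro ⟨r, rfl⟩
    exact hp.not_isUnit (hf p ⟨r, (mul_assoc p p r).symm⟩)
  have hpd : ∀ i, pderiv i p = 0 := by
    intro i
    have h1 := h i
    rw [Derivation.leibniz, smul_eq_mul, smul_eq_mul,
      dvd_add_right (dvd_mul_right _ _)] at h1
    have h2 := (hp.prime.dvd_or_dvd h1).resolve_left hpq
    by_contra h3
    have h4 := totalDegree_le_of_dvd_of_isDomain h2 h3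
    have h5 := totalDegree_pderiv_lt h3
    omega
  have h6 := eq_C_of_pderiv_eq_zero hpd
  have h7 : coeff 0 p ≠ 0 := fun h0 => hp.ne_zero (by rw [h6, h0, C_0])
  exact hp.not_isUnit (h6 ▸ (isUnit_iff_ne_zero.2 h7).map C)

end Reduced

section Squarefree

open MvPolynomial

lemma isHomogeneous_jacobianIdeal {n d : ℕ} {f : PolyRing n} (hf : f.IsHomogeneous d) :
    (jacobianIdeal f).IsHomogeneous (homogeneousSubmodule (Fin (n + 1)) ℂ) := by
  refine Ideal.homogeneous_span _ _ ?_
  rintro _ ⟨i, rfl⟩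
  exact ⟨d - 1, hf.pderiv⟩

lemma mem_jacobianIdeal {n d : ℕ} {f : PolyRing n} (hf : f.IsHomogeneous d) (hd : d ≠ 0) :
    f ∈ jacobianIdeal f := by
  have h := hf.sum_X_mul_pderiv
  have h1 : f = C (d : ℂ)⁻¹ * ∑ i, X i * pderiv i f := by
    rw [h, nsmul_eq_mul, ← mul_assoc, ← map_natCast (C (σ := Fin (n + 1)) (R := ℂ)), ← C_mul,
      inv_mul_cancel₀ (Nat.cast_ne_zero.2 hd), C_1, one_mul]
  rw [h1]
  exact Ideal.mul_mem_left _ _ (sum_mem fun i _ =>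
    Ideal.mul_mem_left _ _ (h1 ▸ Ideal.subset_span ⟨i, rfl⟩))

/-- The singular locus of a reduced hypersurface has codimension at least `2` in `ℙⁿ`. -/
lemma growthLE_jacobianIdeal {n d : ℕ} (hn : 2 ≤ n) {f : PolyRing n} (hf : f.IsHomogeneous d)
    (hd : d ≠ 0) (hred : Squarefree f) : GrowthLE (jacobianIdeal f) (n - 1) := by
  refine growthLE_of_ltSeries (isHomogeneous_jacobianIdeal hf) fun x hx => ?_
  have hx' := x.head.isPrime
  have h0 : f ≠ 0 := hred.ne_zero
  have hfx := hx (mem_jacobianIdeal hf hd)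
  obtain ⟨p, hp, hpf, hpx⟩ : ∃ p, Irreducible p ∧ p ∣ f ∧ p ∈ x.head.asHomogeneousIdeal.toIdeal := by
    obtain ⟨u, hu⟩ := UniqueFactorizationMonoid.factors_prod h0
    have h1 : (UniqueFactorizationMonoid.factors f).prod ∈ x.head.asHomogeneousIdeal.toIdeal := by
      rw [← hu] at hfx
      exact (hx'.mem_or_mem hfx).resolve_right fun h => hx'.ne_top
        (Ideal.eq_top_of_isUnit_mem _ h u.isUnit)
    rw [hx'.multiset_prod_mem_iff_exists_mem] at h1
    obtain ⟨p, hp, hpx⟩ := h1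
    exact ⟨p, UniqueFactorizationMonoid.irreducible_of_factor p hp,
      UniqueFactorizationMonoid.dvd_of_mem_factors hp, hpx⟩
  have hpp : (Ideal.span {p}).IsPrime := (Ideal.span_singleton_prime hp.ne_zero).2 hp.prime
  -- Taking the homogeneous core avoids proving that a factor of a form is a form: the core is a
  -- homogeneous prime and still contains `f`.
  set Q := ((Ideal.span {p}).homogeneousCore (homogeneousSubmodule (Fin (n + 1)) ℂ)).toIdeal with hQ
  have hQp : Q ≤ Ideal.span {p} := Ideal.toIdeal_homogeneousCore_le _ _
  have hfQ : f ∈ Q := Ideal.mem_homogeneousCore_of_homogeneous_of_mem ⟨d, hf⟩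
    (Ideal.mem_span_singleton.2 hpf)
  have hpx' : Ideal.span {p} ≤ x.head.asHomogeneousIdeal.toIdeal :=
    (Ideal.span_singleton_le_iff_mem _).2 hpx
  obtain ⟨i, hi⟩ := exists_X_notMem x.head
  have hiQ : X i ∉ Q := fun h => hi (hpx' (hQp h))
  let y := projPoint (HomogeneousIdeal.isHomogeneous _) hpp.homogeneousCore hiQ
  let z := projPoint (σ := Fin (n + 1)) (K := ℂ) (P := ⊥) (Ideal.IsHomogeneous.bot _)
    Ideal.isPrime_bot (i := i) (X_ne_zero i)
  have hyx : y < x.head := by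
    refine lt_of_le_of_ne (hQp.trans hpx') fun heq => ?_
    obtain ⟨j, hj⟩ := not_dvd_pderiv_of_squarefree hred hp hpf
    have h2 : pderiv j f ∈ x.head.asHomogeneousIdeal.toIdeal := hx (Ideal.subset_span ⟨j, rfl⟩)
    rw [← heq] at h2
    exact hj (Ideal.mem_span_singleton.1 (hQp h2))
  have hzy : z < y := by
    refine lt_of_le_of_ne (bot_le (a := Q)) fun heq => h0 ?_
    have h2 : f ∈ y.asHomogeneousIdeal.toIdeal := hfQ
    rw [← heq] at h2
    exact h2
  -- The chain above `J_f` is lengthened by the two primes `0 < Q`; the growth bound `n + 1` for `S`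
  -- itself then limits the original length to `n - 2`.
  have h3 := growthGE_of_ltSeries _ ((x.cons y hyx).cons z hzy) rfl
  have h4 := h3.anti (bot_le (a := _)) |>.le_of_growthLE growthLE_bot
  have h5 : ((x.cons y hyx).cons z hzy).length = x.length + 1 + 1 :=
    (RelSeries.cons_length _ _ hzy).trans (congrArg (· + 1) (RelSeries.cons_length _ _ hyx))
  rw [h5, Fintype.card_fin] at h4
  omega

end Squarefree

/-! ### Graded free modules and graded maps, one degree at a time. -/

section GradedFree

open MvPolynomial

variable {σ K ι κ μ : Type*} [Field K]

/-- The degree `t` part of `S(-a)`. -/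
noncomputable def shiftedPart (σ K : Type*) [Field K] (a t : ℕ) : Submodule K (MvPolynomial σ K) :=
  if a ≤ t then homogeneousSubmodule σ K (t - a) else ⊥

lemma mem_shiftedPart {a t : ℕ} {p : MvPolynomial σ K} :
    p ∈ shiftedPart σ K a t ↔ (a ≤ t → p.IsHomogeneous (t - a)) ∧ (t < a → p = 0) := by
  unfold shiftedPart
  split_ifs with h
  · simp [h]
  · simp [h, not_le.1 h]

/-- The degree `t` part of `⨁ᵢ S(-aᵢ)`. -/
noncomputable def gradedVec (K : Type*) [Field K] (σ : Type*) (a : ι → ℕ) (t : ℕ) :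
    Submodule K (ι → MvPolynomial σ K) :=
  Submodule.pi Set.univ fun i => shiftedPart σ K (a i) t

lemma mem_gradedVec {a : ι → ℕ} {t : ℕ} {v : ι → MvPolynomial σ K} :
    v ∈ gradedVec K σ a t ↔ ∀ i, v i ∈ shiftedPart σ K (a i) t := by
  simp [gradedVec, Submodule.mem_pi]

/-- The projection of `S(-a)` to its degree `t` part. -/
noncomputable def shiftedComponent (a t : ℕ) : MvPolynomial σ K →ₗ[K] MvPolynomial σ K :=
  if a ≤ t then homogeneousComponent (t - a) else 0

lemma shiftedComponent_mem (a t : ℕ) (p : MvPolynomial σ K) :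
    shiftedComponent a t p ∈ shiftedPart σ K a t := by
  unfold shiftedComponent shiftedPart
  split_ifs with h
  · exact homogeneousComponent_mem _ _
  · exact zero_mem _

lemma shiftedComponent_of_mem {a t t' : ℕ} {p : MvPolynomial σ K} (h : p ∈ shiftedPart σ K a t') :
    shiftedComponent a t p = if t = t' then p else 0 := by
  unfold shiftedComponent
  rw [mem_shiftedPart] at h
  rcases lt_or_ge t' a with h' | h'
  · simp [h.2 h']
  · have h1 := h.1 h'
    split_ifs with h2 h3 h4
    · subst h3
      exact homogeneousComponent_eq_self h1
    · rw [homogeneousComponent_of_mem h1, if_neg (by omega)]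
    · omega
    · rfl

lemma sum_shiftedComponent {a N : ℕ} {p : MvPolynomial σ K} (h : p.totalDegree + a < N) :
    ∑ t ∈ Finset.range N, shiftedComponent a t p = p := by
  obtain ⟨N, rfl⟩ := Nat.exists_eq_add_of_le (show a ≤ N by omega)
  rw [Finset.sum_range_add, Finset.sum_eq_zero, zero_add]
  · have h1 : ∀ t ∈ Finset.range N, shiftedComponent a (a + t) p = homogeneousComponent t p := by
      intro t _
      simp [shiftedComponent]
    rw [Finset.sum_congr rfl h1, ← Finset.sum_subset (s₁ := Finset.range (p.totalDegree + 1))]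
    · exact sum_homogeneousComponent p
    · intro t ht
      simp only [Finset.mem_range] at ht ⊢
      omega
    · intro t _ ht
      simp only [Finset.mem_range, not_lt] at ht
      exact homogeneousComponent_eq_zero _ _ (by omega)
  · intro t ht
    simp only [Finset.mem_range] at ht
    simp [shiftedComponent, not_le.2 ht]

/-- The projection of `⨁ᵢ S(-aᵢ)` to its degree `t` part. -/
noncomputable def vecComponent (a : ι → ℕ) (t : ℕ) :
    (ι → MvPolynomial σ K) →ₗ[K] (ι → MvPolynomial σ K) :=
  LinearMap.pi fun i => shiftedComponent (a i) t ∘ₗ LinearMap.proj i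

lemma vecComponent_apply (a : ι → ℕ) (t : ℕ) (v : ι → MvPolynomial σ K) (i : ι) :
    vecComponent a t v i = shiftedComponent (a i) t (v i) := rfl

lemma vecComponent_mem (a : ι → ℕ) (t : ℕ) (v : ι → MvPolynomial σ K) :
    vecComponent a t v ∈ gradedVec K σ a t :=
  mem_gradedVec.2 fun _ => shiftedComponent_mem _ _ _

lemma vecComponent_of_mem {a : ι → ℕ} {t t' : ℕ} {v : ι → MvPolynomial σ K}
    (h : v ∈ gradedVec K σ a t') : vecComponent a t v = if t = t' then v else 0 := by
  ext1 i
  rw [vecComponent_apply, shiftedComponent_of_mem (mem_gradedVec.1 h i)]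
  split_ifs <;> rfl

lemma exists_sum_vecComponent [Finite ι] (a : ι → ℕ) (v : ι → MvPolynomial σ K) :
    ∃ N₀, ∀ N, N₀ ≤ N → ∑ t ∈ Finset.range N, vecComponent a t v = v := by
  cases nonempty_fintype ι
  refine ⟨∑ i, ((v i).totalDegree + a i) + 1, fun N hN => ?_⟩
  ext1 i
  rw [Finset.sum_apply]
  refine sum_shiftedComponent (p := v i) ?_
  have := Finset.single_le_sum (f := fun i => (v i).totalDegree + a i) (fun _ _ => Nat.zero_le _)
    (Finset.mem_univ i)
  omega

/-- A map `⨁ᵢ S(-aᵢ) → ⨁ⱼ S(-bⱼ)` which is homogeneous of degree `0`. -/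
def IsGradedMap (a : ι → ℕ) (b : κ → ℕ)
    (φ : (ι → MvPolynomial σ K) →ₗ[MvPolynomial σ K] (κ → MvPolynomial σ K)) : Prop :=
  ∀ t, ∀ v ∈ gradedVec K σ a t, φ v ∈ gradedVec K σ b t

/-- This commutation is what allows any preimage of a homogeneous vector to be replaced by a
homogeneous one. -/
lemma IsGradedMap.vecComponent_apply [Finite ι] {a : ι → ℕ} {b : κ → ℕ}
    {φ : (ι → MvPolynomial σ K) →ₗ[MvPolynomial σ K] (κ → MvPolynomial σ K)}
    (hφ : IsGradedMap a b φ) (t : ℕ) (v : ι → MvPolynomial σ K) :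
    vecComponent b t (φ v) = φ (vecComponent a t v) := by
  obtain ⟨N, hN⟩ := exists_sum_vecComponent a v
  have hN' := hN (N + t + 1) (by omega)
  conv_lhs => rw [← hN', map_sum, map_sum]
  rw [Finset.sum_congr rfl fun t' _ => vecComponent_of_mem (hφ t' _ (vecComponent_mem a t' v)),
    Finset.sum_ite_eq, if_pos (Finset.mem_range.2 (by omega))]

/-- The rank of a graded map in degree `t`. -/
noncomputable def gradedRank (a : ι → ℕ)
    (φ : (ι → MvPolynomial σ K) →ₗ[MvPolynomial σ K] (κ → MvPolynomial σ K)) (t : ℕ) : ℕ :=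
  Module.finrank K ((gradedVec K σ a t).map (φ.restrictScalars K))

lemma finrank_shiftedPart (a t : ℕ) : Module.finrank K (shiftedPart σ K a t) =
    if a ≤ t then Module.finrank K (homogeneousSubmodule σ K (t - a)) else 0 := by
  by_cases h : a ≤ t
  · rw [shiftedPart, if_pos h, if_pos h]
  · rw [shiftedPart, if_neg h, if_neg h, finrank_bot]

variable [Finite σ]

instance (a t : ℕ) : Module.Finite K (shiftedPart σ K a t) := by
  by_cases h : a ≤ t
  · rw [shiftedPart, if_pos h]; infer_instance
  · rw [shiftedPart, if_neg h]; infer_instance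

/-- The degree `t` part of `⨁ᵢ S(-aᵢ)` as a product. -/
noncomputable def gradedVecEquiv (a : ι → ℕ) (t : ℕ) :
    gradedVec K σ a t ≃ₗ[K] ∀ i, shiftedPart σ K (a i) t where
  toFun v i := ⟨v.1 i, mem_gradedVec.1 v.2 i⟩
  invFun v := ⟨fun i => v i, mem_gradedVec.2 fun i => (v i).2⟩
  left_inv _ := rfl
  right_inv _ := rfl
  map_add' _ _ := rfl
  map_smul' _ _ := rfl

instance [Finite ι] (a : ι → ℕ) (t : ℕ) : Module.Finite K (gradedVec K σ a t) :=
  Module.Finite.equiv (gradedVecEquiv a t).symm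

lemma finrank_gradedVec [Fintype ι] (a : ι → ℕ) (t : ℕ) :
    Module.finrank K (gradedVec K σ a t) =
      ∑ i, if a i ≤ t then Module.finrank K (homogeneousSubmodule σ K (t - a i)) else 0 := by
  rw [(gradedVecEquiv a t).finrank_eq, Module.finrank_pi_fintype]
  exact Finset.sum_congr rfl fun i _ => finrank_shiftedPart _ _

lemma gradedRank_add_gradedRank [Finite ι] [Finite κ] {a : ι → ℕ} {b : κ → ℕ}
    {φ : (ι → MvPolynomial σ K) →ₗ[MvPolynomial σ K] (κ → MvPolynomial σ K)}
    {ψ : (κ → MvPolynomial σ K) →ₗ[MvPolynomial σ K] (μ → MvPolynomial σ K)}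
    (hφ : IsGradedMap a b φ) (h : Function.Exact φ ψ) (t : ℕ) :
    gradedRank a φ t + gradedRank b ψ t = Module.finrank K (gradedVec K σ b t) := by
  have h1 := (ψ.restrictScalars K ∘ₗ (gradedVec K σ b t).subtype).finrank_range_add_finrank_ker
  rw [LinearMap.range_comp, Submodule.range_subtype] at h1
  rw [← h1, add_comm, gradedRank, gradedRank]
  congr 1
  have h2 : (gradedVec K σ a t).map (φ.restrictScalars K) ≤ gradedVec K σ b t := by
    rintro _ ⟨v, hv, rfl⟩
    exact hφ t v hv
  rw [← (Submodule.comapSubtypeEquivOfLe h2).finrank_eq]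
  suffices h3 : Submodule.comap (gradedVec K σ b t).subtype
      ((gradedVec K σ a t).map (φ.restrictScalars K)) =
      LinearMap.ker (ψ.restrictScalars K ∘ₗ (gradedVec K σ b t).subtype) by rw [h3]
  ext ⟨w, hw⟩
  simp only [Submodule.mem_comap, Submodule.subtype_apply, LinearMap.mem_ker, LinearMap.comp_apply,
    LinearMap.restrictScalars_apply, Submodule.mem_map]
  constructor
  · rintro ⟨v, -, rfl⟩
    exact h.apply_apply_eq_zero v
  · intro hw'
    obtain ⟨v, rfl⟩ := (h w).1 hw'
    refine ⟨vecComponent a t v, vecComponent_mem a t v, ?_⟩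
    rw [← hφ.vecComponent_apply, vecComponent_of_mem hw, if_pos rfl]

lemma hilb_add_gradedRank [Finite ι] {a : ι → ℕ}
    {φ : (ι → MvPolynomial σ K) →ₗ[MvPolynomial σ K] (Unit → MvPolynomial σ K)}
    (hφ : IsGradedMap a 0 φ) {I : Ideal (MvPolynomial σ K)}
    (hI : ∀ p, p ∈ I ↔ ∃ v, φ v = fun _ => p) (t : ℕ) :
    hilb I t + gradedRank a φ t = Module.finrank K (homogeneousSubmodule σ K t) := by
  have h1 := (partMk I t).finrank_range_add_finrank_ker
  rw [range_partMk] at h1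
  rw [← h1, hilb, gradedRank]
  congr 1
  refine (LinearEquiv.finrank_eq (LinearEquiv.ofLinearMap (R := K) ?_ ?_ ?_ ?_)).symm
  · exact LinearMap.codRestrict _ (LinearMap.pi fun _ =>
      (homogeneousSubmodule σ K t).subtype ∘ₗ (LinearMap.ker (partMk I t)).subtype) fun p => by
        obtain ⟨v, hv⟩ := (hI p.1.1).1 (mem_ker_partMk.1 p.2)
        refine ⟨vecComponent a t v, vecComponent_mem a t v, ?_⟩
        rw [LinearMap.restrictScalars_apply, ← hφ.vecComponent_apply, hv]
        refine (vecComponent_of_mem (t' := t) (mem_gradedVec.2 fun _ => ?_)).trans (if_pos rfl)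
        rw [mem_shiftedPart]
        exact ⟨fun _ => p.1.2, fun h => absurd h (by simp)⟩
  · refine LinearMap.codRestrict _ (LinearMap.codRestrict _
      (LinearMap.proj () ∘ₗ Submodule.subtype _) ?_) ?_
    · rintro ⟨_, v, hv, rfl⟩
      exact (mem_shiftedPart.1 (mem_gradedVec.1 (hφ t v hv) ())).1 (Nat.zero_le _)
    · rintro ⟨_, v, hv, rfl⟩
      exact mem_ker_partMk.2 ((hI _).2 ⟨v, rfl⟩)
  · rfl
  · rfl

end GradedFree

/-! ### The Hilbert function of the polynomial ring. -/

section PolynomialRing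

open MvPolynomial

variable {K : Type*} [Field K]

lemma finrank_homogeneousSubmodule (n t : ℕ) :
    Module.finrank K (homogeneousSubmodule (Fin (n + 1)) K t) = (n + t).choose n := by
  have h1 : Nat.card {m : Fin (n + 1) →₀ ℕ | m.degree = t} = (n + t).choose n := by
    refine (Nat.card_congr (Sym.equivNatSum (Fin (n + 1)) t)).symm.trans ?_
    rw [Nat.card_eq_fintype_card,
      Sym.card_sym_eq_choose, Fintype.card_fin, Nat.add_right_comm, Nat.add_sub_cancel,
      Nat.choose_symm_add]
  have : Finite {m : Fin (n + 1) →₀ ℕ | m.degree = t} :=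
    Nat.finite_of_card_ne_zero (by rw [h1]; exact (Nat.choose_pos (by omega)).ne')
  cases nonempty_fintype {m : Fin (n + 1) →₀ ℕ | m.degree = t}
  rw [homogeneousSubmodule_eq_finsupp_supported,
    (AddMonoidAlgebra.supportedEquivFinsupp (R := K) (S := K) _).finrank_eq,
    Module.finrank_finsupp_self, ← Nat.card_eq_fintype_card, h1]

end PolynomialRing

/-! ### The Hilbert series of `M(f)` read off from the resolution. -/

section HilbertSeries

open MvPolynomial

/-- The polynomial `∑ᵢ X ^ aᵢ`. -/
noncomputable def degreePoly {ι : Type*} [Fintype ι] (a : ι → ℕ) : Polynomial ℚ :=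
  ∑ i, Polynomial.X ^ a i

lemma coeff_invOneSubPow (n t : ℕ) :
    PowerSeries.coeff t (PowerSeries.invOneSubPow ℚ (n + 1)).val = ((n + t).choose n : ℚ) := by
  rw [PowerSeries.invOneSubPow_val_succ_eq_mk_add_choose, PowerSeries.coeff_mk]

lemma finrank_gradedVec_eq_coeff {K ι : Type*} [Field K] [Fintype ι] {n : ℕ} (a : ι → ℕ) (t : ℕ) :
    (Module.finrank K (gradedVec K (Fin (n + 1)) a t) : ℚ) =
      PowerSeries.coeff t
        ((degreePoly a : PowerSeries ℚ) * (PowerSeries.invOneSubPow ℚ (n + 1)).val) := by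
  rw [finrank_gradedVec, degreePoly, ← Polynomial.coeToPowerSeries.ringHom_apply, map_sum,
    Finset.sum_mul, map_sum, Nat.cast_sum]
  refine Finset.sum_congr rfl fun i _ => ?_
  rw [Polynomial.coeToPowerSeries.ringHom_apply, Polynomial.coe_pow, Polynomial.coe_X,
    PowerSeries.coeff_X_pow_mul', coeff_invOneSubPow, finrank_homogeneousSubmodule]
  split_ifs <;> simp

/-- The map `S^{n+1}(1-d) → S` given by the partial derivatives. -/
noncomputable def gradientMap {n m : ℕ} (f : PolyRing n) (e : Fin m → Fin (n + 1)) :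
    (Fin m → PolyRing n) →ₗ[PolyRing n] (Unit → PolyRing n) :=
  LinearMap.pi fun _ => ∑ i, (LinearMap.mulRight (PolyRing n) (pderiv (e i) f)) ∘ₗ LinearMap.proj i

lemma gradientMap_apply {n m : ℕ} (f : PolyRing n) (e : Fin m → Fin (n + 1))
    (v : Fin m → PolyRing n) :
    gradientMap f e v = fun _ => ∑ i, v i * pderiv (e i) f := by
  ext1 u
  simp [gradientMap]

lemma isGradedMap_gradientMap {n m d : ℕ} {f : PolyRing n} (hf : f.IsHomogeneous d)
    (e : Fin m → Fin (n + 1)) {a : Fin m → ℕ} (ha : ∀ i, a i = d - 1) :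
    IsGradedMap (K := ℂ) a 0 (gradientMap f e) := by
  intro t v hv
  rw [gradientMap_apply, mem_gradedVec]
  refine fun _ => sum_mem fun i _ => mem_shiftedPart.2 ⟨fun _ => ?_, fun h => absurd h (by simp)⟩
  have h1 := mem_shiftedPart.1 (mem_gradedVec.1 hv i)
  rw [ha] at h1
  rcases lt_or_ge t (d - 1) with h | h
  · rw [h1.2 h, zero_mul]
    exact isHomogeneous_zero _ _ _
  · have h2 := (h1.1 h).mul (hf.pderiv (i := e i))
    rw [Nat.sub_add_cancel h] at h2
    exact h2

lemma isHomogeneousVector_iff {n m : ℕ} {a : Fin m → ℕ} {t : ℕ} {v : Fin m → PolyRing n} :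
    IsHomogeneousVector a t v ↔ v ∈ gradedVec ℂ (Fin (n + 1)) a t := by
  rw [mem_gradedVec]
  exact forall_congr' fun i => mem_shiftedPart.symm

namespace MinimalResolution

variable {n d : ℕ} {f : PolyRing n} (R : MinimalResolution d f)

/-- The degrees of the generators of `E_k`. -/
def genDeg (k : ℕ) (i : Fin (R.m k)) : ℕ := d - 1 + R.deg k i

lemma isGradedMap_diff (k : ℕ) : IsGradedMap (R.genDeg (k + 1)) (R.genDeg k) (R.diff k) :=
  fun t v hv => isHomogeneousVector_iff.1
    (R.diff_homogeneous k t v (isHomogeneousVector_iff.2 hv))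

/-- The map `E_0 → S`. -/
noncomputable def aug : (Fin (R.m 0) → PolyRing n) →ₗ[PolyRing n] (Unit → PolyRing n) :=
  gradientMap f (Fin.cast R.rank_zero)

lemma isGradedMap_aug (hf : f.IsHomogeneous d) : IsGradedMap (R.genDeg 0) 0 R.aug :=
  isGradedMap_gradientMap hf _ fun i => by rw [genDeg, R.deg_zero, add_zero]

lemma exact_aug : Function.Exact (R.diff 0) R.aug := by
  intro v
  rw [← R.exact_zero v, aug, gradientMap_apply, funext_iff]
  simp

lemma mem_jacobianIdeal_iff (p : PolyRing n) :
    p ∈ jacobianIdeal f ↔ ∃ v, R.aug v = fun _ => p := by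
  rw [jacobianIdeal, Ideal.mem_span_range_iff_exists_fun]
  constructor
  · rintro ⟨c, hc⟩
    refine ⟨fun i => c (Fin.cast R.rank_zero i), ?_⟩
    rw [aug, gradientMap_apply, ← hc]
    ext1 _
    exact Equiv.sum_comp (finCongr R.rank_zero) fun i => c i * pderiv i f
  · rintro ⟨v, hv⟩
    refine ⟨fun i => v (Fin.cast R.rank_zero.symm i), ?_⟩
    rw [aug, gradientMap_apply] at hv
    rw [← congrFun hv ()]
    exact (Equiv.sum_comp (finCongr R.rank_zero)
      fun i => v (Fin.cast R.rank_zero.symm i) * pderiv i f).symm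

/-- The numerator of the Hilbert series of `M(f)`. -/
noncomputable def numerator : Polynomial ℚ :=
  1 - degreePoly (R.genDeg 0) +
    ∑ k ∈ Finset.Icc 1 n, (-1) ^ (k + 1) * degreePoly (R.genDeg k)

/-- By exactness each graded dimension is a sum of two consecutive ranks, so the alternating sum
telescopes. At `N = n` the remaining rank vanishes because `E_{n+1} = 0`. -/
lemma sum_finrank_eq (t N : ℕ) :
    ∑ k ∈ Finset.Icc 1 N, (-1 : ℚ) ^ (k + 1) *
      (Module.finrank ℂ (gradedVec ℂ (Fin (n + 1)) (R.genDeg k) t) : ℚ) =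
    gradedRank (R.genDeg 1) (R.diff 0) t -
      (-1) ^ N * gradedRank (R.genDeg (N + 1)) (R.diff N) t := by
  induction N with
  | zero => simp
  | succ N ih =>
    rw [Finset.sum_Icc_succ_top (by omega), ih,
      ← gradedRank_add_gradedRank (R.isGradedMap_diff (N + 1)) (R.exact N) t]
    push_cast
    ring

lemma hilb_eq_coeff (hf : f.IsHomogeneous d) (t : ℕ) :
    (hilb (jacobianIdeal f) t : ℚ) = PowerSeries.coeff t
      ((R.numerator : PowerSeries ℚ) * (PowerSeries.invOneSubPow ℚ (n + 1)).val) := by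
  have h1 := hilb_add_gradedRank (R.isGradedMap_aug hf) R.mem_jacobianIdeal_iff t
  have h2 := gradedRank_add_gradedRank (R.isGradedMap_diff 0) R.exact_aug t
  have h3 : gradedRank (R.genDeg (n + 1)) (R.diff n) t = 0 := by
    have := R.rank_eq_zero (n + 1) (by omega)
    have : IsEmpty (Fin (R.m (n + 1))) := by rw [this]; infer_instance
    exact Nat.eq_zero_of_le_zero ((Submodule.finrank_map_le _ _).trans
      (by rw [finrank_gradedVec, Finset.univ_eq_empty, Finset.sum_empty]))
  have h4 := R.sum_finrank_eq t n
  rw [h3, Nat.cast_zero, mul_zero, sub_zero] at h4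
  have h5 : PowerSeries.coeff t
      ((R.numerator : PowerSeries ℚ) * (PowerSeries.invOneSubPow ℚ (n + 1)).val) =
      Module.finrank ℂ (homogeneousSubmodule (Fin (n + 1)) ℂ t) -
        Module.finrank ℂ (gradedVec ℂ (Fin (n + 1)) (R.genDeg 0) t) +
        ∑ k ∈ Finset.Icc 1 n, (-1 : ℚ) ^ (k + 1) *
          (Module.finrank ℂ (gradedVec ℂ (Fin (n + 1)) (R.genDeg k) t) : ℚ) := by
    simp_rw [finrank_gradedVec_eq_coeff]
    rw [finrank_homogeneousSubmodule, ← coeff_invOneSubPow, numerator,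
      ← Polynomial.coeToPowerSeries.ringHom_apply, map_add, map_sub, map_one, map_sum, add_mul,
      sub_mul, one_mul, map_add, map_sub, Finset.sum_mul, map_sum]
    congr 1
    refine Finset.sum_congr rfl fun k _ => ?_
    have h6 : ((-1 : Polynomial ℚ) ^ (k + 1)) = Polynomial.C ((-1) ^ (k + 1)) := by simp
    rw [h6, Polynomial.coeToPowerSeries.ringHom_apply, Polynomial.coe_mul, Polynomial.coe_C,
      mul_assoc,
      PowerSeries.coeff_C_mul]
  rw [h5, h4, ← h1, ← h2]
  push_cast
  ring

/-- Partial sums of coefficients amount to one more factor `1 / (1 - X)`, hence the exponent `n +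
2`. -/
lemma cumHilb_eq_coeff (hf : f.IsHomogeneous d) (T : ℕ) :
    (cumHilb (jacobianIdeal f) T : ℚ) = PowerSeries.coeff T
      ((R.numerator : PowerSeries ℚ) * (PowerSeries.invOneSubPow ℚ (n + 2)).val) := by
  rw [show n + 2 = n + 1 + 1 from rfl, PowerSeries.invOneSubPow_add, Units.val_mul, ← mul_assoc,
    PowerSeries.coeff_mul, Finset.Nat.sum_antidiagonal_eq_sum_range_succ_mk, cumHilb, Nat.cast_sum]
  refine Finset.sum_congr rfl fun t _ => ?_
  rw [R.hilb_eq_coeff hf, coeff_invOneSubPow]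
  simp

end MinimalResolution

end HilbertSeries

/-! ### Shifted power moments and the order of vanishing at `1`. -/

section Moments

open Polynomial

/-- The functional `∑ᵢ pᵢ Xⁱ ↦ ∑ᵢ pᵢ (i - b) ^ j`. -/
noncomputable def moment (b : ℚ) (j : ℕ) : ℚ[X] →ₗ[ℚ] ℚ :=
  (basisMonomials ℚ).constr ℚ fun i => ((i : ℚ) - b) ^ j

lemma basisMonomials_apply (a : ℕ) : basisMonomials ℚ a = X ^ a := by
  rw [coe_basisMonomials]
  exact monomial_one_right_eq_X_pow a

lemma moment_X_pow (b : ℚ) (j a : ℕ) : moment b j (X ^ a) = ((a : ℚ) - b) ^ j := by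
  have h := (basisMonomials ℚ).constr_basis ℚ (fun i : ℕ => ((i : ℚ) - b) ^ j) a
  rw [basisMonomials_apply] at h
  exact h

lemma ext_X_pow {M : Type*} [AddCommMonoid M] [Module ℚ M] {φ ψ : ℚ[X] →ₗ[ℚ] M}
    (h : ∀ a, φ (X ^ a) = ψ (X ^ a)) : φ = ψ :=
  (basisMonomials ℚ).ext fun a => by
    rw [basisMonomials_apply]; exact h a

/-- Multiplication by `1 - X` acts on the weights as a finite difference, which lowers the degree in
the exponent: `x^j - (x+1)^j` involves only powers below `j`. -/
lemma moment_one_sub_X_mul (b : ℚ) (j : ℕ) (q : ℚ[X]) :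
    moment b j ((1 - X) * q) = -∑ i ∈ Finset.range j, (j.choose i : ℚ) * moment b i q := by
  have h : moment b j ∘ₗ LinearMap.mulLeft ℚ (1 - X : ℚ[X]) =
      -∑ i ∈ Finset.range j, (j.choose i : ℚ) • moment b i := by
    refine ext_X_pow fun a => ?_
    rw [LinearMap.comp_apply, LinearMap.mulLeft_apply, sub_mul, one_mul, ← pow_succ', map_sub,
      moment_X_pow, moment_X_pow, LinearMap.neg_apply, LinearMap.sum_apply]
    simp_rw [LinearMap.smul_apply, moment_X_pow, smul_eq_mul]
    have h1 := add_pow ((a : ℚ) - b) 1 j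
    rw [Finset.sum_range_succ] at h1
    simp only [one_pow, mul_one, Nat.choose_self, Nat.cast_one] at h1
    push_cast
    rw [add_sub_right_comm, h1]
    simp_rw [mul_comm]
    ring
  have := LinearMap.congr_fun h q
  simpa using this

lemma moment_one_sub_X_pow_mul (b : ℚ) (c : ℕ) (q : ℚ[X]) :
    (∀ j < c, moment b j ((1 - X) ^ c * q) = 0) ∧
      moment b c ((1 - X) ^ c * q) = (-1) ^ c * c.factorial * q.eval 1 := by
  induction c with
  | zero =>
    refine ⟨fun j hj => absurd hj (by omega), ?_⟩
    have h : moment b 0 = Polynomial.leval 1 := by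
      refine ext_X_pow fun a => ?_
      rw [moment_X_pow]
      simp [Polynomial.leval]
    rw [h]
    simp [Polynomial.leval]
  | succ c ih =>
    constructor
    · intro j hj
      rw [pow_succ', mul_assoc, moment_one_sub_X_mul, Finset.sum_eq_zero, neg_zero]
      intro i hi
      rw [ih.1 i (by rw [Finset.mem_range] at hi; omega), mul_zero]
    · rw [pow_succ', mul_assoc, moment_one_sub_X_mul, Finset.sum_range_succ, Finset.sum_eq_zero,
        ih.2, Nat.choose_succ_self_right, Nat.factorial_succ]
      · push_cast; ring
      · intro i hi
        rw [ih.1 i (by rwa [Finset.mem_range] at hi), mul_zero]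

end Moments

/-! ### Degree and leading coefficient of Hilbert polynomials, and polynomial growth. -/

section HilbertPolynomial

open Polynomial

lemma natDegree_hilbertPoly_le (q : ℚ[X]) (m : ℕ) : (hilbertPoly q (m + 1)).natDegree ≤ m := by
  rw [hilbertPoly_succ]
  refine natDegree_sum_le_of_forall_le _ _ fun i _ => (natDegree_smul_le _ _).trans ?_
  rw [natDegree_preHilbertPoly]

lemma coeff_hilbertPoly (q : ℚ[X]) (m : ℕ) :
    (hilbertPoly q (m + 1)).coeff m = q.eval 1 / m.factorial := by
  rw [hilbertPoly_succ, finsetSum_coeff, eval_eq_sum, Polynomial.sum, Finset.sum_div]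
  refine Finset.sum_congr rfl fun i _ => ?_
  rw [coeff_smul, coeff_preHilbertPoly_self, one_pow, mul_one, smul_eq_mul, div_eq_mul_inv]

lemma natDegree_hilbertPoly {q : ℚ[X]} (hq : q.eval 1 ≠ 0) (m : ℕ) :
    (hilbertPoly q (m + 1)).natDegree = m := by
  refine natDegree_eq_of_le_of_coeff_ne_zero (natDegree_hilbertPoly_le q m) ?_
  rw [coeff_hilbertPoly]
  exact div_ne_zero hq (Nat.cast_ne_zero.2 (Nat.factorial_ne_zero m))

lemma leadingCoeff_hilbertPoly {q : ℚ[X]} (hq : q.eval 1 ≠ 0) (m : ℕ) :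
    (hilbertPoly q (m + 1)).leadingCoeff = q.eval 1 / m.factorial := by
  rw [leadingCoeff, natDegree_hilbertPoly hq, coeff_hilbertPoly]

lemma exists_eq_one_sub_X_pow_mul {p : ℚ[X]} (hp : p ≠ 0) :
    ∃ c q, p = (1 - X) ^ c * q ∧ q.eval 1 ≠ 0 := by
  obtain ⟨q, hq, hq'⟩ := exists_eq_pow_rootMultiplicity_mul_and_not_dvd p hp 1
  refine ⟨p.rootMultiplicity 1, (-1) ^ p.rootMultiplicity 1 * q, ?_, ?_⟩
  · rw [← mul_assoc, ← mul_pow, mul_neg_one, neg_sub]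
    exact hq
  · rw [dvd_iff_isRoot] at hq'
    simpa using hq'

lemma eventually_natCast_of_atTop {p : ℚ → Prop} (h : ∀ᶠ x in Filter.atTop, p x) :
    ∃ T₀ : ℕ, ∀ T : ℕ, T₀ ≤ T → p T :=
  Filter.eventually_atTop.1 (tendsto_natCast_atTop_atTop.eventually h)

lemma natDegree_le_of_forall_le {F : ℕ → ℕ} {P : ℚ[X]} {T₀ C s : ℕ}
    (hP : ∀ T, T₀ ≤ T → (F T : ℚ) = P.eval (T : ℚ)) (hF : ∀ T, 1 ≤ F T)
    (h : ∀ T, F T ≤ C * (T + 1) ^ s) : P.natDegree ≤ s := by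
  by_contra! hs
  set Q : ℚ[X] := Polynomial.C (C : ℚ) * (X + Polynomial.C 1) ^ s with hQ
  have hdeg : Q.degree < P.degree := by
    rw [degree_eq_natDegree (ne_zero_of_natDegree_gt hs)]
    refine lt_of_le_of_lt (degree_mul_le _ _) ?_
    rw [degree_pow, degree_X_add_C, nsmul_one]
    exact lt_of_le_of_lt (add_le_add_left degree_C_le _) (by simpa using hs)
  -- If `P` had degree above `s`, the bound `Q` would eventually be at most `P / 2`, so `F T ≤ F T /
  -- 2`, contradicting `F T ≥ 1`.
  obtain ⟨T₁, hT₁⟩ := eventually_natCast_of_atTop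
    ((isLittleO_atTop_of_degree_lt Q P hdeg).def (c := 1 / 2) (by norm_num))
  set T := max T₀ T₁
  have h1 := hT₁ T (le_max_right _ _)
  have h2 : Q.eval (T : ℚ) = ((C * (T + 1) ^ s : ℕ) : ℚ) := by simp [hQ]
  rw [← hP T (le_max_left _ _), h2, ← Rat.norm_cast_real, ← Rat.norm_cast_real, Rat.cast_natCast,
    Rat.cast_natCast, Real.norm_natCast, Real.norm_natCast] at h1
  have h3 : (F T : ℝ) ≤ ((C * (T + 1) ^ s : ℕ) : ℝ) := Nat.cast_le.2 (h T)
  have h4 : (1 : ℝ) ≤ F T := Nat.one_le_cast.2 (hF T)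
  linarith

lemma exists_le_of_natDegree_le {F : ℕ → ℕ} (hmono : Monotone F) {P : ℚ[X]} {T₀ s : ℕ}
    (hP : ∀ T, T₀ ≤ T → (F T : ℚ) = P.eval (T : ℚ)) (h : P.natDegree ≤ s) :
    ∃ C, ∀ T, F T ≤ C * (T + 1) ^ s := by
  have hdeg : P.degree ≤ (X ^ s : ℚ[X]).degree := by
    rw [degree_X_pow]
    exact natDegree_le_iff_degree_le.1 h
  obtain ⟨c, hc⟩ := (isBigO_atTop_of_degree_le P (X ^ s) hdeg).bound
  obtain ⟨T₁, hT₁⟩ := eventually_natCast_of_atTop hc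
  obtain ⟨C, hC⟩ := exists_nat_ge c
  refine ⟨F (max T₀ T₁) + C, fun T => ?_⟩
  rw [add_mul]
  rcases le_total T (max T₀ T₁) with hT | hT
  · exact (hmono hT).trans ((Nat.le_mul_of_pos_right _ (by positivity)).trans
      (Nat.le_add_right _ _))
  · refine le_trans ?_ (Nat.le_add_left _ _)
    have h1 := hT₁ T ((le_max_right _ _).trans hT)
    rw [← hP T ((le_max_left _ _).trans hT), eval_pow, eval_X, ← Nat.cast_pow,
      ← Rat.norm_cast_real, ← Rat.norm_cast_real, Rat.cast_natCast,
      Rat.cast_natCast, Real.norm_natCast, Real.norm_natCast] at h1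
    have h2 : (F T : ℝ) ≤ ((C * T ^ s : ℕ) : ℝ) := by
      refine h1.trans ?_
      rw [Nat.cast_mul]
      gcongr
    exact (Nat.cast_le.1 h2).trans (by gcongr; omega)

end HilbertPolynomial

/-! ### Growth of the Jacobian algebra and the pole order of its series. -/

section Growth

open Polynomial

lemma jacobianIdeal_ne_top {n d : ℕ} {f : PolyRing n} (hf : f.IsHomogeneous d) (hd : 2 ≤ d) :
    jacobianIdeal f ≠ ⊤ := by
  intro h
  have h1 : jacobianIdeal f ≤ RingHom.ker (MvPolynomial.constantCoeff (σ := Fin (n + 1)) (R := ℂ)) := by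
    refine Ideal.span_le.2 ?_
    rintro _ ⟨i, rfl⟩
    exact IsHomogeneous.constantCoeff_eq_zero hf.pderiv (by omega)
  have h2 : (1 : PolyRing n) ∈ jacobianIdeal f := h ▸ Submodule.mem_top
  simpa using h1 h2

/-- After cancelling `(1 - X)^c` the cumulative function is eventually a polynomial of degree
exactly `m - c`. If `c > m` it would eventually be zero, although it is at least `1` for a proper
ideal. -/
lemma growthLE_iff_of_coeff {σ : Type*} [Finite σ] {I : Ideal (MvPolynomial σ ℂ)} (hI : I ≠ ⊤)
    {m c : ℕ} {q : ℚ[X]} (hq : q.eval 1 ≠ 0)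
    (h : ∀ T, (cumHilb I T : ℚ) = PowerSeries.coeff T
      ((((1 - X) ^ c * q : ℚ[X]) : PowerSeries ℚ) * (PowerSeries.invOneSubPow ℚ (m + 1)).val)) :
    c ≤ m ∧ ∀ s, GrowthLE I s ↔ m ≤ c + s := by
  have h1 : ∀ T, ((1 - X) ^ c * q).natDegree + 1 ≤ T →
      (cumHilb I T : ℚ) = (hilbertPoly ((1 - X) ^ c * q) (m + 1)).eval (T : ℚ) := fun T hT => by
    rw [h T, coeff_mul_invOneSubPow_eq_hilbertPoly_eval (m + 1) (by omega)]
  have hc : c ≤ m := by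
    by_contra! hc
    obtain ⟨k, rfl⟩ := Nat.exists_eq_add_of_lt hc
    have h2 : hilbertPoly ((1 - X) ^ (m + k + 1) * q) (m + 1) = 0 := by
      have h3 := hilbertPoly_mul_one_sub_pow_add ((1 - X) ^ k * q) 0 (m + 1)
      rw [zero_add] at h3
      rw [show m + k + 1 = k + (m + 1) by ring, pow_add, mul_right_comm, h3,
        hilbertPoly_zero_right]
    have h3 := h1 _ le_rfl
    rw [h2, eval_zero, Nat.cast_eq_zero] at h3
    have := one_le_cumHilb hI (((1 - X) ^ (m + k + 1) * q).natDegree + 1)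
    omega
  refine ⟨hc, fun s => ?_⟩
  have h4 : (hilbertPoly ((1 - X) ^ c * q) (m + 1)).natDegree = m - c := by
    rw [mul_comm, show m + 1 = m - c + 1 + c by omega, hilbertPoly_mul_one_sub_pow_add,
      natDegree_hilbertPoly hq]
  constructor
  · rintro ⟨C, hC⟩
    have := natDegree_le_of_forall_le h1 (one_le_cumHilb hI) hC
    omega
  · intro hs
    exact exists_le_of_natDegree_le (cumHilb_mono I) h1 (by omega)

end Growth

/-! ### The numbers `σ_j` as moments of the numerator; parts (1) and (2). -/

section Sigma

open Polynomial

namespace MinimalResolution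

variable {n d : ℕ} {f : PolyRing n} (R : MinimalResolution d f)

lemma moment_degreePoly_genDeg (j k : ℕ) :
    moment ((d - 1 : ℕ) : ℚ) j (degreePoly (R.genDeg k)) = ∑ i, (R.deg k i : ℚ) ^ j := by
  rw [degreePoly, map_sum]
  refine Finset.sum_congr rfl fun i _ => ?_
  rw [moment_X_pow, genDeg, Nat.cast_add, add_sub_cancel_left]

lemma moment_numerator (j : ℕ) : moment ((d - 1 : ℕ) : ℚ) j R.numerator =
    (-((d - 1 : ℕ) : ℚ)) ^ j - (n + 1) * 0 ^ j + R.sigma j := by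
  have h1 := moment_X_pow ((d - 1 : ℕ) : ℚ) j 0
  rw [pow_zero, Nat.cast_zero, zero_sub] at h1
  rw [numerator, map_add, map_sub, map_sum, sigma, moment_degreePoly_genDeg, h1]
  simp_rw [R.deg_zero]
  push_cast
  congr 1
  · simp [R.rank_zero]
  · refine Finset.sum_congr rfl fun k _ => ?_
    have h6 : ((-1 : ℚ[X]) ^ (k + 1)) = Polynomial.C ((-1) ^ (k + 1)) := by simp
    rw [h6, ← smul_eq_C_mul, map_smul, moment_degreePoly_genDeg, smul_eq_mul]

lemma numerator_ne_zero (hf : f.IsHomogeneous d) (hd : 2 ≤ d) : R.numerator ≠ 0 := by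
  intro h
  have h1 := R.cumHilb_eq_coeff hf 0
  rw [h, Polynomial.coe_zero, zero_mul, map_zero, Nat.cast_eq_zero] at h1
  have := one_le_cumHilb (jacobianIdeal_ne_top hf hd) 0
  omega

end MinimalResolution

end Sigma

section Sigma

open Polynomial

/-- The order of vanishing at `1` is the index of the first nonzero moment, whatever the centre `b`.
-/
lemma eq_iff_moment {c m : ℕ} {p q : ℚ[X]} (b : ℚ) (hq : q.eval 1 ≠ 0)
    (hp : p = (1 - X) ^ c * q) :
    c = m ↔ (∀ j < m, moment b j p = 0) ∧ moment b m p ≠ 0 := by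
  obtain ⟨h1, h2⟩ := moment_one_sub_X_pow_mul b c q
  rw [← hp] at h1 h2
  have h3 : moment b c p ≠ 0 := by
    rw [h2]
    exact mul_ne_zero (mul_ne_zero (pow_ne_zero _ (by norm_num))
      (Nat.cast_ne_zero.2 (Nat.factorial_ne_zero c))) hq
  constructor
  · rintro rfl
    exact ⟨h1, h3⟩
  · rintro ⟨h4, h5⟩
    rcases lt_trichotomy c m with h | h | h
    · exact absurd (h4 c h) h3
    · exact h
    · exact absurd (h1 m h) h5

namespace MinimalResolution

variable {n d : ℕ} {f : PolyRing n} (R : MinimalResolution d f)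

lemma exists_numerator_eq (hf : f.IsHomogeneous d) (hd : 2 ≤ d) :
    ∃ c q, R.numerator = (1 - X) ^ c * q ∧ q.eval 1 ≠ 0 ∧ c ≤ n + 1 ∧
      ∀ s, GrowthLE (jacobianIdeal f) s ↔ n + 1 ≤ c + s := by
  obtain ⟨c, q, hN, hq⟩ := exists_eq_one_sub_X_pow_mul (R.numerator_ne_zero hf hd)
  obtain ⟨h1, h2⟩ := growthLE_iff_of_coeff (m := n + 1) (jacobianIdeal_ne_top hf hd) hq
    fun T => by rw [← hN]; exact R.cumHilb_eq_coeff hf T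
  exact ⟨c, q, hN, hq, h1, h2⟩

lemma moment_numerator_eq_zero_iff {j : ℕ} (hj : 1 ≤ j) (hd : 1 ≤ d) :
    moment ((d - 1 : ℕ) : ℚ) j R.numerator = 0 ↔
      R.sigma j = (-1) ^ (j + 1) * ((d : ℤ) - 1) ^ j := by
  rw [R.moment_numerator, zero_pow (by omega), mul_zero, sub_zero, neg_pow, Nat.cast_sub hd,
    add_comm, add_eq_zero_iff_eq_neg, ← neg_one_mul, ← mul_assoc, ← pow_succ', Nat.cast_one]
  exact_mod_cast Iff.rfl

lemma isHilbertPolynomial (hf : f.IsHomogeneous d) :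
    IsHilbertPolynomial f (hilbertPoly R.numerator (n + 1)) := by
  refine ⟨R.numerator.natDegree + 1, fun k hk => ?_⟩
  rw [← coeff_mul_invOneSubPow_eq_hilbertPoly_eval (n + 1) (by omega : R.numerator.natDegree < k),
    ← R.hilb_eq_coeff hf]
  rfl

lemma singularDim_eq_iff (hf : f.IsHomogeneous d) {c : ℕ}
    (hc : ∀ s, GrowthLE (jacobianIdeal f) s ↔ n + 1 ≤ c + s) {δ : ℕ} :
    singularDim f = (δ : WithBot ℕ∞) ↔ c + δ = n := by
  rw [singularDim, singularLocus, krullDim_zeroLocus_eq_iff (isHomogeneous_jacobianIdeal hf), hc, hc]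
  omega

lemma sigma_zero_one (hn : 2 ≤ n) (hd : 3 ≤ d) (hf : f.IsHomogeneous d) (hred : Squarefree f) :
    R.sigma 0 = (n : ℤ) ∧ R.sigma 1 = (d : ℤ) - 1 := by
  obtain ⟨c, q, hN, hq, -, hc⟩ := R.exists_numerator_eq hf (by omega)
  have h2 := (hc _).1 (growthLE_jacobianIdeal hn hf (by omega) hred)
  obtain ⟨h3, -⟩ := moment_one_sub_X_pow_mul ((d - 1 : ℕ) : ℚ) c q
  rw [← hN] at h3
  constructor
  · have h4 := h3 0 (by omega)
    rw [R.moment_numerator, pow_zero, pow_zero] at h4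
    have h5 : (R.sigma 0 : ℚ) = n := by linarith
    exact_mod_cast h5
  · have h4 := (R.moment_numerator_eq_zero_iff le_rfl (by omega)).1 (h3 1 (by omega))
    rw [h4]
    ring

lemma singularDim_iff (hn : 2 ≤ n) (hd : 3 ≤ d) (hf : f.IsHomogeneous d) (hred : Squarefree f)
    {δ : ℕ} (hδ : δ ≤ n - 2) :
    singularDim f = (δ : WithBot ℕ∞) ↔
      (∀ j : ℕ, 1 ≤ j → j < n - δ → R.sigma j = (-1) ^ (j + 1) * ((d : ℤ) - 1) ^ j) ∧
        R.sigma (n - δ) ≠ (-1) ^ (n - δ + 1) * ((d : ℤ) - 1) ^ (n - δ) := by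
  obtain ⟨c, q, hN, hq, -, hc⟩ := R.exists_numerator_eq hf (by omega)
  rw [singularDim_eq_iff hf hc, show c + δ = n ↔ c = n - δ by omega,
    eq_iff_moment ((d - 1 : ℕ) : ℚ) hq hN, ne_eq, ne_eq,
    R.moment_numerator_eq_zero_iff (by omega) (by omega)]
  refine and_congr_left fun _ => forall_congr' fun j => ?_
  -- The zeroth moment vanishes automatically, as `1 - (n + 1) + σ_0 = 0`; this is why the criterion
  -- starts at `j = 1`.
  rcases Nat.eq_zero_or_pos j with rfl | hj
  · have h := (R.sigma_zero_one hn hd hf hred).1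
    simp [R.moment_numerator, h]
  · rw [R.moment_numerator_eq_zero_iff hj (by omega)]
    exact ⟨fun h _ => h, fun h => h hj⟩

lemma degree_formula (hn : 2 ≤ n) (hd : 3 ≤ d) (hf : f.IsHomogeneous d)
    {δ : ℕ} (hδ : δ ≤ n - 2) (h : singularDim f = (δ : WithBot ℕ∞)) :
    HasSingularDegree f
        ((((d : ℚ) - 1) ^ (n - δ) + (-1) ^ (n - δ) * (R.sigma (n - δ) : ℚ)) /
          ((n - δ).factorial : ℚ)) ∧
      0 < (((d : ℚ) - 1) ^ (n - δ) + (-1) ^ (n - δ) * (R.sigma (n - δ) : ℚ)) /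
          ((n - δ).factorial : ℚ) := by
  obtain ⟨c, q, hN, hq, -, hc⟩ := R.exists_numerator_eq hf (by omega)
  have hcδ : n - δ = c := by
    have := (singularDim_eq_iff hf hc).1 h
    omega
  have h1 : (((d : ℚ) - 1) ^ (n - δ) + (-1) ^ (n - δ) * (R.sigma (n - δ) : ℚ)) /
      ((n - δ).factorial : ℚ) = q.eval 1 := by
    obtain ⟨-, h2⟩ := moment_one_sub_X_pow_mul ((d - 1 : ℕ) : ℚ) c q
    rw [← hN, R.moment_numerator, zero_pow (by omega), mul_zero, sub_zero, neg_pow,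
      Nat.cast_sub (by omega), Nat.cast_one] at h2
    have h3 : ((-1 : ℚ) ^ c) * (-1) ^ c = 1 := by rw [← mul_pow]; norm_num
    rw [hcδ, div_eq_iff (Nat.cast_ne_zero.2 (Nat.factorial_ne_zero c))]
    linear_combination ((-1 : ℚ) ^ c) * h2 + (c.factorial * q.eval 1 - ((d : ℚ) - 1) ^ c) * h3
  have hP : hilbertPoly R.numerator (n + 1) = hilbertPoly q (δ + 1) := by
    rw [hN, mul_comm, show n + 1 = δ + 1 + c by omega, hilbertPoly_mul_one_sub_pow_add]
  have hH := R.isHilbertPolynomial hf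
  rw [hP] at hH
  rw [h1]
  refine ⟨⟨_, hH, ?_, ?_⟩, ?_⟩
  · rw [natDegree_hilbertPoly hq, h]
  · rw [natDegree_hilbertPoly hq, leadingCoeff_hilbertPoly hq]
  · refine lt_of_le_of_ne ?_ hq.symm
    by_contra! hneg
    have hlc : (hilbertPoly q (δ + 1)).leadingCoeff < 0 := by
      rw [leadingCoeff_hilbertPoly hq]
      exact div_neg_of_neg_of_pos hneg (Nat.cast_pos.2 (Nat.factorial_pos δ))
    obtain ⟨T₁, hT₁⟩ : ∃ T₁ : ℕ, ∀ T : ℕ, T₁ ≤ T → (hilbertPoly q (δ + 1)).eval (T : ℚ) < 0 := by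
      -- A negative leading coefficient makes the Hilbert polynomial eventually negative; a constant
      -- polynomial does not tend to `-∞` and is treated apart.
      rcases Nat.eq_zero_or_pos δ with rfl | hδ0
      · refine ⟨0, fun T _ => ?_⟩
        rw [eq_C_of_natDegree_le_zero (natDegree_hilbertPoly_le q 0), eval_C]
        rwa [leadingCoeff, natDegree_hilbertPoly hq] at hlc
      · refine eventually_natCast_of_atTop (p := fun x => (hilbertPoly q (δ + 1)).eval x < 0)
          ((tendsto_atBot_of_leadingCoeff_nonpos _ ?_ hlc.le).eventually (Filter.eventually_lt_atBot 0))
        rw [← natDegree_pos_iff_degree_pos, natDegree_hilbertPoly hq]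
        exact hδ0
    obtain ⟨k₀, hk₀⟩ := hH
    have h2 := hT₁ _ (le_max_left T₁ k₀)
    rw [← hk₀ _ (le_max_right T₁ k₀)] at h2
    exact absurd h2 (not_lt.2 (Nat.cast_nonneg _))

end MinimalResolution

end Sigma

/-! ### Koszul numerics imply smoothness. -/

section SmoothOfNumerator

open Polynomial

lemma exists_hilb_eq_zero {σ K : Type*} [Field K] {I : Ideal (MvPolynomial σ K)}
    (h : GrowthLE I 0) : ∃ t, hilb I t = 0 := by
  by_contra! h0
  obtain ⟨C, hC⟩ := h
  have h1 : ∀ T, T + 1 ≤ cumHilb I T := by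
    intro T
    have h2 := Finset.card_nsmul_le_sum (Finset.range (T + 1)) (hilb I) 1
      fun t _ => Nat.one_le_iff_ne_zero.2 (h0 t)
    rwa [Finset.card_range, smul_eq_mul, mul_one] at h2
  have h2 := h1 C
  have h3 := hC C
  rw [pow_zero, mul_one] at h3
  omega

namespace MinimalResolution

variable {n d : ℕ} {f : PolyRing n} (R : MinimalResolution d f)

/-- All generators of `E_k` sit in degree `(k + 1)(d - 1)`, also for `k = 0`, so the numerator is a
binomial expansion. -/
lemma numerator_eq_of_koszul
    (h : ∀ k : ℕ, 1 ≤ k → k ≤ n →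
      R.m k = (n + 1).choose (k + 1) ∧ ∀ i, R.deg k i = k * (d - 1)) :
    R.numerator = (1 - X ^ (d - 1)) ^ (n + 1) := by
  have h0 : ∀ k, k ≤ n → degreePoly (R.genDeg k) =
      ((n + 1).choose (k + 1) : ℚ[X]) * (X ^ (d - 1)) ^ (k + 1) := by
    intro k hk
    have h1 : R.m k = (n + 1).choose (k + 1) ∧ ∀ i, R.deg k i = k * (d - 1) := by
      rcases Nat.eq_zero_or_pos k with rfl | hk0
      · exact ⟨by simp [R.rank_zero], fun i => by simp [R.deg_zero]⟩
      · exact h k hk0 hk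
    have h2 : ∀ i, R.genDeg k i = (d - 1) * (k + 1) := fun i => by rw [genDeg, h1.2]; ring
    rw [degreePoly, Finset.sum_congr rfl fun i _ => by rw [h2], Finset.sum_const, Finset.card_univ,
      Fintype.card_fin, h1.1, nsmul_eq_mul, pow_mul]
  rw [numerator, h0 0 (Nat.zero_le n), sub_eq_neg_add (1 : ℚ[X]) (X ^ (d - 1)), add_pow, Finset.sum_range_succ',
    Finset.range_eq_Ico, ← Finset.sum_Ioo_add_eq_sum_Ico (Nat.succ_pos n)]
  have h3 : Finset.Ioo 0 (n + 1) = Finset.Icc 1 n := by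
    ext k
    simp only [Finset.mem_Ioo, Finset.mem_Icc]
    omega
  rw [h3, Finset.sum_congr rfl fun k hk => by rw [h0 k (Finset.mem_Icc.1 hk).2]]
  have h4 : ∀ k, (-X ^ (d - 1) : ℚ[X]) ^ (k + 1) * 1 ^ (n + 1 - (k + 1)) *
      ((n + 1).choose (k + 1) : ℚ[X]) =
      (-1) ^ (k + 1) * (((n + 1).choose (k + 1) : ℚ[X]) * (X ^ (d - 1)) ^ (k + 1)) := by
    intro k
    rw [neg_pow, one_pow]
    ring
  simp_rw [h4]
  simp
  ring

lemma smooth_of_koszul (hd : 2 ≤ d) (hf : f.IsHomogeneous d)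
    (h : ∀ k : ℕ, 1 ≤ k → k ≤ n →
      R.m k = (n + 1).choose (k + 1) ∧ ∀ i, R.deg k i = k * (d - 1)) :
    IsSmoothHypersurface f := by
  have h1 : R.numerator = (1 - X) ^ (n + 1) * (∑ i ∈ Finset.range (d - 1), X ^ i) ^ (n + 1) := by
    rw [R.numerator_eq_of_koszul h, ← mul_pow, mul_comm, geom_sum_mul_neg]
  have hq : ((∑ i ∈ Finset.range (d - 1), X ^ i : ℚ[X]) ^ (n + 1)).eval 1 ≠ 0 := by
    rw [eval_pow, eval_geom_sum]
    simp only [one_pow, Finset.sum_const, Finset.card_range, nsmul_eq_mul, mul_one]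
    exact pow_ne_zero _ (Nat.cast_ne_zero.2 (by omega))
  obtain ⟨-, h2⟩ := growthLE_iff_of_coeff (m := n + 1) (jacobianIdeal_ne_top hf hd) hq
    fun T => by rw [← h1]; exact R.cumHilb_eq_coeff hf T
  -- Bounded growth forces `M(f)_t = 0` for some `t`, so every `x_i^t` lies in `J_f` and a common
  -- zero of the partials must be the origin.
  obtain ⟨t, ht⟩ := exists_hilb_eq_zero ((h2 0).2 le_rfl)
  intro x hx _
  by_contra! h3
  refine hx (funext fun i => ?_)
  have h4 : jacobianIdeal f ≤ RingHom.ker (MvPolynomial.eval x) := by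
    refine Ideal.span_le.2 ?_
    rintro _ ⟨j, rfl⟩
    exact h3 j
  have h5 := h4 (mem_of_hilb_eq_zero ht (MvPolynomial.isHomogeneous_X_pow i t))
  rw [RingHom.mem_ker, map_pow, MvPolynomial.eval_X] at h5
  exact eq_zero_of_pow_eq_zero h5

end MinimalResolution

end SmoothOfNumerator

/-! ### Koszul complexes as iterated mapping cones, with explicit homotopies. -/

section Koszul

/-- A Koszul complex of `g : Fin q → A`: a free module on a finite type graded by a weight, with a
differential of weight `-1` and, for every `j`, a homotopy between multiplication by `g j`
and zero. -/
structure Koszul {A : Type*} [CommRing A] {q : ℕ} (g : Fin q → A) where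
  /-- the index type of the basis -/
  index : Type
  [fintype : Fintype index]
  [decEq : DecidableEq index]
  /-- the homological degree -/
  weight : index → ℕ
  /-- the differential -/
  diff : (index → A) →ₗ[A] (index → A)
  /-- the homotopies -/
  htpy : Fin q → (index → A) →ₗ[A] (index → A)
  /-- the basis element of weight zero -/
  base : index
  /-- the basis elements of weight one -/
  gen : Fin q → index
  card_weight : ∀ k, (∑ a, if weight a = k then 1 else 0) = q.choose k
  diff_diff : ∀ v, diff (diff v) = 0
  diff_weight : ∀ k v, (∀ a, weight a ≠ k + 1 → v a = 0) → ∀ a, weight a ≠ k → diff v a = 0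
  diff_of_weight_zero : ∀ v, (∀ a, weight a ≠ 0 → v a = 0) → diff v = 0
  htpy_weight : ∀ j k v, (∀ a, weight a ≠ k → v a = 0) → ∀ a, weight a ≠ k + 1 → htpy j v a = 0
  htpy_spec : ∀ j v, diff (htpy j v) + htpy j (diff v) = g j • v
  -- Stated for additive subgroups, so that it applies both to the forms of a fixed degree and to
  -- the polynomials without constant term.
  diff_mem : ∀ (P : AddSubgroup A), (∀ j, g j ∈ P) → ∀ a b, diff (Pi.single a 1) b ∈ P
  weight_base : weight base = 0
  weight_gen : ∀ j, weight (gen j) = 1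
  eq_base : ∀ a, weight a = 0 → a = base
  gen_injective : Function.Injective gen
  exists_gen : ∀ a, weight a = 1 → ∃ j, gen j = a
  diff_gen : ∀ j, diff (Pi.single (gen j) 1) base = g j

attribute [instance] Koszul.fintype Koszul.decEq

namespace Koszul

variable {A : Type*} [CommRing A]

/-- The mapping cone of `g + φ : (α → A) → (α → A)`. -/
def coneMap {α : Type*} (φ ψ : (α → A) →ₗ[A] (α → A)) (c : A) :
    (α ⊕ α → A) →ₗ[A] (α ⊕ α → A) where
  toFun v := Sum.elim (φ (v ∘ Sum.inl) + c • (v ∘ Sum.inr)) (ψ (v ∘ Sum.inr))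
  map_add' v w := by
    have h1 : (v + w) ∘ Sum.inl = v ∘ Sum.inl + w ∘ Sum.inl := rfl
    have h2 : (v + w) ∘ Sum.inr = v ∘ Sum.inr + w ∘ Sum.inr := rfl
    rw [h1, h2]
    ext (a | a)
    · simp
      ring
    · simp
  map_smul' r v := by
    have h1 : (r • v) ∘ Sum.inl = r • (v ∘ Sum.inl) := rfl
    have h2 : (r • v) ∘ Sum.inr = r • (v ∘ Sum.inr) := rfl
    rw [h1, h2]
    ext (a | a)
    · simp
      ring
    · simp

lemma coneMap_inl {α : Type*} (φ ψ : (α → A) →ₗ[A] (α → A)) (c : A) (v : α ⊕ α → A) :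
    coneMap φ ψ c v ∘ Sum.inl = φ (v ∘ Sum.inl) + c • (v ∘ Sum.inr) := rfl

lemma coneMap_inr {α : Type*} (φ ψ : (α → A) →ₗ[A] (α → A)) (c : A) (v : α ⊕ α → A) :
    coneMap φ ψ c v ∘ Sum.inr = ψ (v ∘ Sum.inr) := rfl

/-- The map `(x, y) ↦ (0, x)`. -/
def shiftMap (α : Type*) : (α ⊕ α → A) →ₗ[A] (α ⊕ α → A) where
  toFun v := Sum.elim 0 (v ∘ Sum.inl)
  map_add' v w := by ext (a | a) <;> simp
  map_smul' r v := by ext (a | a) <;> simp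

omit [CommRing A] in
lemma sum_ext {α : Type*} {v w : α ⊕ α → A} (h1 : v ∘ Sum.inl = w ∘ Sum.inl)
    (h2 : v ∘ Sum.inr = w ∘ Sum.inr) : v = w := by
  ext (a | a)
  · exact congrFun h1 a
  · exact congrFun h2 a

/-- The Koszul complex of the empty sequence. -/
def nil (g : Fin 0 → A) : Koszul g where
  index := Unit
  weight _ := 0
  diff := 0
  htpy j := j.elim0
  base := ()
  gen j := j.elim0
  card_weight k := by cases k <;> simp
  diff_diff _ := rfl
  diff_weight _ _ _ _ _ := rfl
  diff_of_weight_zero _ _ := rfl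
  htpy_weight j := j.elim0
  htpy_spec j := j.elim0
  diff_mem P _ _ _ := P.zero_mem
  weight_base := rfl
  weight_gen j := j.elim0
  eq_base _ _ := rfl
  gen_injective j := j.elim0
  exists_gen _ h := absurd h (by simp)
  diff_gen j := j.elim0

/-- The Koszul complex of a sequence with one more element, as a mapping cone. -/
def cons {q : ℕ} {g : Fin (q + 1) → A} (K : Koszul fun j => g j.succ) : Koszul g where
  index := K.index ⊕ K.index
  weight := Sum.elim K.weight fun a => K.weight a + 1
  diff := coneMap K.diff (-K.diff) (g 0)
  htpy := Fin.cons (shiftMap K.index) fun j => coneMap (K.htpy j) (-K.htpy j) 0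
  base := Sum.inl K.base
  gen := Fin.cons (Sum.inr K.base) fun j => Sum.inl (K.gen j)
  card_weight k := by
    rw [Fintype.sum_sum_type]
    change (∑ a, if K.weight a = k then 1 else 0) +
      (∑ a, if K.weight a + 1 = k then 1 else 0) = _
    rw [K.card_weight]
    cases k with
    | zero => simp
    | succ k =>
      simp only [Nat.add_right_cancel_iff]
      rw [K.card_weight, Nat.choose_succ_succ, add_comm]
  diff_diff v := by
    refine sum_ext ?_ ?_
    · rw [coneMap_inl, coneMap_inl, coneMap_inr, map_add, K.diff_diff, map_smul]
      ext a
      simp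
    · rw [coneMap_inr, coneMap_inr]
      simp only [LinearMap.neg_apply, map_neg, K.diff_diff]
      ext a
      simp
  diff_weight k v hv := by
    have h1 : ∀ a, K.weight a ≠ k + 1 → (v ∘ Sum.inl) a = 0 := fun a ha => hv (Sum.inl a) ha
    have h2 : ∀ a, K.weight a ≠ k → (v ∘ Sum.inr) a = 0 := fun a ha =>
      hv (Sum.inr a) (by simpa using ha)
    rintro (a | a) ha
    · have h3 := K.diff_weight k _ h1 a ha
      have h4 := h2 a ha
      simp only [Function.comp_apply] at h4
      simp [coneMap, h3, h4]
    · cases k with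
      | zero =>
        have h3 := K.diff_of_weight_zero _ h2
        simp [coneMap, h3]
      | succ k =>
        have h3 := K.diff_weight k _ h2 a (by simpa using ha)
        simp [coneMap, h3]
  diff_of_weight_zero v hv := by
    have h1 : ∀ a, K.weight a ≠ 0 → (v ∘ Sum.inl) a = 0 := fun a ha => hv (Sum.inl a) ha
    have h2 : v ∘ Sum.inr = 0 := funext fun a => hv (Sum.inr a) (by simp)
    refine sum_ext ?_ ?_
    · rw [coneMap_inl, K.diff_of_weight_zero _ h1, h2, smul_zero, add_zero]
      rfl
    · rw [coneMap_inr, h2, map_zero]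
      rfl
  htpy_weight j k v hv := by
    have h1 : ∀ a, K.weight a ≠ k → (v ∘ Sum.inl) a = 0 := fun a ha => hv (Sum.inl a) ha
    refine Fin.cases ?_ (fun j => ?_) j
    · rintro (a | a) ha
      · simp [shiftMap]
      · exact h1 a (by simpa using ha)
    · rintro (a | a) ha
      · have h3 := K.htpy_weight j k _ h1 a ha
        simp [coneMap, h3]
      · cases k with
        | zero =>
          have h2 : v ∘ Sum.inr = 0 := funext fun a => hv (Sum.inr a) (by simp)
          simp [coneMap, h2]
        | succ k =>
          have h2 : ∀ a, K.weight a ≠ k → (v ∘ Sum.inr) a = 0 := fun a ha =>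
            hv (Sum.inr a) (by simpa using ha)
          have h3 := K.htpy_weight j k _ h2 a (by simpa using ha)
          simp [coneMap, h3]
  htpy_spec j v := by
    refine Fin.cases ?_ (fun j => ?_) j
    · refine sum_ext ?_ ?_
      · ext a
        simp [shiftMap, coneMap]
      · ext a
        simp [shiftMap, coneMap]
    · have h1 := fun v a => congrFun (K.htpy_spec j v) a
      simp only [Pi.add_apply, Pi.smul_apply, smul_eq_mul] at h1
      refine sum_ext ?_ ?_
      · ext a
        simp [coneMap]
        have h2 := h1 (v ∘ Sum.inl) a
        simp only [Function.comp_apply] at h2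
        linear_combination h2
      · ext a
        have h2 := h1 (v ∘ Sum.inr) a
        simp only [Function.comp_apply] at h2
        simp [coneMap, h2]
  diff_mem P hP a b := by
    have h0 := P.zero_mem
    rcases a with a | a
    · have h1 : (Pi.single (Sum.inl a) 1 : K.index ⊕ K.index → A) ∘ Sum.inl = Pi.single a 1 := by
        ext b
        simp [Pi.single_apply]
      have h2 : (Pi.single (Sum.inl a) 1 : K.index ⊕ K.index → A) ∘ Sum.inr = 0 := by
        ext b
        simp
      have h3 := K.diff_mem P (fun j => hP j.succ) a
      rcases b with b | b
      · simpa [coneMap, h1, h2] using h3 b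
      · simp [coneMap, h2]
    · have h1 : (Pi.single (Sum.inr a) 1 : K.index ⊕ K.index → A) ∘ Sum.inr = Pi.single a 1 := by
        ext b
        simp [Pi.single_apply]
      have h2 : (Pi.single (Sum.inr a) 1 : K.index ⊕ K.index → A) ∘ Sum.inl = 0 := by
        ext b
        simp
      have h3 := K.diff_mem P (fun j => hP j.succ) a
      rcases b with b | b
      · rcases eq_or_ne b a with rfl | hb
        · simpa [coneMap, h1, h2] using hP 0
        · simp [coneMap, h2, hb]
      · simpa [coneMap, h1, h2] using P.neg_mem (h3 b)
  weight_base := K.weight_base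
  weight_gen j := by
    refine Fin.cases ?_ (fun j => ?_) j
    · simp [K.weight_base]
    · simp [K.weight_gen]
  eq_base a ha := by
    rcases a with a | a
    · rw [K.eq_base a ha]
    · simp at ha
  gen_injective := by
    rw [Fin.cons_injective_iff]
    refine ⟨by simp, fun i j h => K.gen_injective (Sum.inl_injective h)⟩
  exists_gen a ha := by
    rcases a with a | a
    · obtain ⟨j, hj⟩ := K.exists_gen a ha
      exact ⟨j.succ, by simp [hj]⟩
    · exact ⟨0, by simp [K.eq_base a (by simpa using ha)]⟩
  diff_gen j := by
    refine Fin.cases ?_ (fun j => ?_) j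
    · have h2 : (Pi.single (Sum.inr K.base) 1 : K.index ⊕ K.index → A) ∘ Sum.inl = 0 := by
        ext b
        simp
      simp [coneMap, h2]
    · have h1 : (Pi.single (Sum.inl (K.gen j)) 1 : K.index ⊕ K.index → A) ∘ Sum.inl =
          Pi.single (K.gen j) 1 := by
        ext b
        simp [Pi.single_apply]
      have h2 : (Pi.single (Sum.inl (K.gen j)) 1 : K.index ⊕ K.index → A) ∘ Sum.inr = 0 := by
        ext b
        simp
      simp [coneMap, h1, h2, K.diff_gen]

end Koszul

end Koszul

/-! ### Exactness of the Koszul complex of the partials of a smooth hypersurface. -/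

section KoszulExact

variable {A : Type*} [CommRing A]

/-- The Koszul complex of `g`. -/
def koszul : ∀ {q : ℕ} (g : Fin q → A), Koszul g
  | 0, g => Koszul.nil g
  | _ + 1, g => Koszul.cons (koszul fun j => g j.succ)

lemma apply_mem_of_forall_mem {α β : Type*} [Finite α] (φ : (α → A) →ₗ[A] (β → A)) {Y : Ideal A}
    {v : α → A} (hv : ∀ a, v a ∈ Y) (b : β) : φ v b ∈ Y := by
  classical
  cases nonempty_fintype α
  rw [pi_eq_sum_univ' v, map_sum, Finset.sum_apply]
  refine sum_mem fun a _ => ?_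
  rw [map_smul]
  exact Ideal.mul_mem_right _ _ (hv a)

namespace Koszul

variable {q : ℕ} {g : Fin q → A} (K : Koszul g)

/-- The elements of homological degree `k`. -/
def HasWeight (k : ℕ) (v : K.index → A) : Prop := ∀ a, K.weight a ≠ k → v a = 0

/-- Exactness of the Koszul complex over `A ⧸ Y` in homological degree `k`. -/
def ExactMod (Y : Ideal A) (k : ℕ) : Prop :=
  ∀ v, K.HasWeight k v → (∀ a, K.diff v a ∈ Y) →
    ∃ u, K.HasWeight (k + 1) u ∧ ∀ a, (v - K.diff u) a ∈ Y

lemma exactMod_of_lt (Y : Ideal A) {k : ℕ} (hk : q < k) : K.ExactMod Y k := by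
  intro v hv _
  have h : v = 0 := by
    ext a
    refine hv a fun ha => ?_
    have h1 := K.card_weight k
    rw [Nat.choose_eq_zero_of_lt hk, Finset.sum_eq_zero_iff] at h1
    simpa [ha] using h1 a (Finset.mem_univ a)
  exact ⟨0, fun _ _ => rfl, fun a => by simp [h]⟩

lemma exists_htpy {y : A} (hy : y ∈ Ideal.span (Set.range g)) :
    ∃ s : (K.index → A) →ₗ[A] (K.index → A),
      (∀ k v, K.HasWeight k v → K.HasWeight (k + 1) (s v)) ∧
      ∀ v, K.diff (s v) + s (K.diff v) = y • v := by
  obtain ⟨c, rfl⟩ := Ideal.mem_span_range_iff_exists_fun.1 hy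
  refine ⟨∑ j, c j • K.htpy j, fun k v hv a ha => ?_, fun v => ?_⟩
  · rw [LinearMap.sum_apply, Finset.sum_apply]
    refine Finset.sum_eq_zero fun j _ => ?_
    rw [LinearMap.smul_apply, Pi.smul_apply, K.htpy_weight j k v hv a ha, smul_zero]
  · simp only [LinearMap.sum_apply, LinearMap.smul_apply, map_sum, map_smul]
    rw [← Finset.sum_add_distrib, Finset.sum_smul]
    refine Finset.sum_congr rfl fun j _ => ?_
    rw [← smul_add, K.htpy_spec, smul_smul]

/-- Let `s` be a homotopy for `y`. If `v` is a cycle modulo `Y`, then `d(s v) ≡ y v`, so `s v` is a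
cycle modulo `Y + (y)` and `s v ≡ d u + y z` modulo `Y`. Applying `d` gives `y v ≡ y d z`, and `y`
cancels. -/
lemma ExactMod.of_sup {Y : Ideal A} {y : A} (hy : y ∈ Ideal.span (Set.range g))
    (hreg : ∀ z, y * z ∈ Y → z ∈ Y) {k : ℕ} (h : K.ExactMod (Y ⊔ Ideal.span {y}) (k + 1)) :
    K.ExactMod Y k := by
  intro v hv hdv
  obtain ⟨s, hs, hs'⟩ := K.exists_htpy hy
  have h1 : ∀ a, K.diff (s v) a = y * v a - s (K.diff v) a := fun a => by
    rw [eq_sub_iff_add_eq]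
    exact congrFun (hs' v) a
  have h2 : ∀ a, s (K.diff v) a ∈ Y := apply_mem_of_forall_mem s hdv
  obtain ⟨u, hu, hu'⟩ := h (s v) (hs k v hv) fun a => by
    rw [h1]
    exact sub_mem (Ideal.mem_sup_right (Ideal.mul_mem_right _ _ (Ideal.mem_span_singleton_self y)))
      (Ideal.mem_sup_left (h2 a))
  have hw : K.HasWeight (k + 1) (s v - K.diff u) := fun a ha => by
    rw [Pi.sub_apply, hs k v hv a ha, K.diff_weight (k + 1) u hu a ha, sub_zero]
  have h3 : ∀ a, ∃ z, (K.weight a ≠ k + 1 → z = 0) ∧ (s v - K.diff u) a - y * z ∈ Y := by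
    intro a
    by_cases ha : K.weight a = k + 1
    · obtain ⟨i, hi, x, hx, hix⟩ := Submodule.mem_sup.1 (hu' a)
      obtain ⟨z, rfl⟩ := Ideal.mem_span_singleton.1 hx
      refine ⟨z, fun h => absurd ha h, ?_⟩
      rw [← hix, add_sub_cancel_right]
      exact hi
    · refine ⟨0, fun _ => rfl, ?_⟩
      rw [hw a ha, mul_zero, sub_zero]
      exact Y.zero_mem
  choose z hz hz' using h3
  refine ⟨z, hz, fun a => hreg _ ?_⟩
  have h4 := apply_mem_of_forall_mem K.diff (v := s v - K.diff u - y • z) hz' a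
  rw [map_sub, map_sub, K.diff_diff, sub_zero, map_smul, Pi.sub_apply, h1, Pi.smul_apply,
    smul_eq_mul] at h4
  have h5 := add_mem h4 (h2 a)
  rw [Pi.sub_apply, mul_sub]
  convert h5 using 1
  ring

lemma exactMod_bot {y : ℕ → A} (hy : ∀ i < q, y i ∈ Ideal.span (Set.range g))
    (hreg : ∀ i < q, ∀ z, y i * z ∈ Ideal.span (y '' Set.Iio i) → z ∈ Ideal.span (y '' Set.Iio i))
    {k : ℕ} (hk : 0 < k) : K.ExactMod ⊥ k := by
  -- Modulo all `q` elements, exactness is known only in degrees above `q`, where the complex is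
  -- zero. Dropping one element of the regular sequence gains one degree, so dropping all of them
  -- reaches every `k > 0`.
  have h : ∀ l ≤ q, ∀ k, q < k + l → K.ExactMod (Ideal.span (y '' Set.Iio (q - l))) k := by
    intro l
    induction l with
    | zero => exact fun _ k hk => K.exactMod_of_lt _ hk
    | succ l ih =>
      intro hl k hk
      refine ExactMod.of_sup K (hy (q - (l + 1)) (by omega)) (hreg _ (by omega)) ?_
      have h1 := ih (by omega) (k + 1) (by omega)
      have h2 : Set.Iio (q - l) = Set.Iio (q - (l + 1)) ∪ {q - (l + 1)} := by
        ext i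
        simp only [Set.mem_Iio, Set.mem_union, Set.mem_singleton_iff]
        omega
      rwa [h2, Set.image_union, Set.image_singleton, Ideal.span_union] at h1
  have h1 := h q le_rfl k (by omega)
  rwa [Nat.sub_self, show Set.Iio 0 = (∅ : Set ℕ) from Set.Iio_bot, Set.image_empty,
    Ideal.span_empty] at h1

end Koszul

open MvPolynomial in
-- For a monomial ideal membership is tested on monomials, and a factor `X i ^ N` does not affect
-- divisibility by powers of other variables.
lemma mem_span_X_pow_of_mul_mem {σ R : Type*} [CommRing R] {N : ℕ} {B : Set σ} {i : σ} (hi : i ∉ B)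
    {z : MvPolynomial σ R}
    (h : X i ^ N * z ∈ Ideal.span ((fun j => (X j : MvPolynomial σ R) ^ N) '' B)) :
    z ∈ Ideal.span ((fun j => (X j : MvPolynomial σ R) ^ N) '' B) := by
  have h1 : (fun j => (X j : MvPolynomial σ R) ^ N) '' B =
      (fun s => monomial s (1 : R)) '' ((fun j => Finsupp.single j N) '' B) := by
    rw [Set.image_image]
    simp_rw [X_pow_eq_monomial]
  rw [h1, mem_ideal_span_monomial_image] at h ⊢
  intro m hm
  obtain ⟨_, ⟨j, hj, rfl⟩, hle⟩ := h (Finsupp.single i N + m) (by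
    rw [mem_support_iff, X_pow_eq_monomial, coeff_monomial_mul, one_mul]
    exact mem_support_iff.1 hm)
  refine ⟨_, ⟨j, hj, rfl⟩, ?_⟩
  have hij : i ≠ j := fun h => hi (h ▸ hj)
  rw [Finsupp.single_le_iff] at hle ⊢
  simpa [Finsupp.single_eq_of_ne' hij] using hle

open MvPolynomial in
lemma koszul_exactMod_bot_of_X_mem_radical {n : ℕ} {K : Type*} [Field K]
    {g : Fin (n + 1) → MvPolynomial (Fin (n + 1)) K}
    (h : ∀ i, (X i : MvPolynomial (Fin (n + 1)) K) ∈ (Ideal.span (Set.range g)).radical) {k : ℕ}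
    (hk : 0 < k) : (koszul g).ExactMod ⊥ k := by
  choose N hN using h
  have hN' : ∀ i, (X i : MvPolynomial (Fin (n + 1)) K) ^ (∑ j, N j) ∈ Ideal.span (Set.range g) :=
    fun i => Ideal.pow_mem_of_pow_mem _ (hN i)
      (Finset.single_le_sum (f := N) (fun _ _ => Nat.zero_le _) (Finset.mem_univ i))
  refine Koszul.exactMod_bot (koszul g)
    (y := fun i => (X (Fin.ofNat (n + 1) i) : MvPolynomial (Fin (n + 1)) K) ^ (∑ j, N j))
    (fun i _ => hN' _) (fun i hi z hz => ?_) hk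
  have h1 : (fun i => (X (Fin.ofNat (n + 1) i) : MvPolynomial (Fin (n + 1)) K) ^ (∑ j, N j)) ''
      Set.Iio i = (fun j => (X j : MvPolynomial (Fin (n + 1)) K) ^ (∑ j, N j)) ''
        (Fin.ofNat (n + 1) '' Set.Iio i) := by rw [Set.image_image]
  rw [h1] at hz ⊢
  refine mem_span_X_pow_of_mul_mem ?_ hz
  rintro ⟨j, hj, hji⟩
  have h2 := congrArg Fin.val hji
  rw [Set.mem_Iio] at hj
  simp only [Fin.val_ofNat] at h2
  rw [Nat.mod_eq_of_lt hi, Nat.mod_eq_of_lt (by omega)] at h2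
  omega

open MvPolynomial in
-- Nullstellensatz. By Euler's formula `f ∈ J_f`, so a common zero of the partials lies on `X` and
-- must be the origin.
lemma X_mem_radical_of_smooth {n d : ℕ} {f : PolyRing n} (hf : f.IsHomogeneous d) (hd : d ≠ 0)
    (h : IsSmoothHypersurface f) (i : Fin (n + 1)) : X i ∈ (jacobianIdeal f).radical := by
  rw [← vanishingIdeal_zeroLocus_eq_radical (K := ℂ), mem_vanishingIdeal_iff]
  intro x hx
  rw [mem_zeroLocus_iff] at hx
  by_contra hi
  obtain ⟨j, hj⟩ := h x (fun h0 => hi (by simp [h0])) (by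
    have := hx f (mem_jacobianIdeal hf hd)
    rwa [aeval_eq_eval] at this)
  refine hj ?_
  have := hx (pderiv j f) (Ideal.subset_span ⟨j, rfl⟩)
  rwa [aeval_eq_eval] at this

end KoszulExact

/-! ### Uniqueness of minimal graded covers. -/

section GradedComparison

open MvPolynomial

variable {σ K ι κ ι' κ' : Type*} [Field K]

lemma smul_mem_gradedVec {s t : ℕ} {b : ι → ℕ} {p : MvPolynomial σ K}
    (hp : p ∈ shiftedPart σ K s t) {w : ι → MvPolynomial σ K} (hw : w ∈ gradedVec K σ b s) :
    p • w ∈ gradedVec K σ b t := by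
  rw [mem_gradedVec] at hw ⊢
  intro i
  rw [Pi.smul_apply, smul_eq_mul]
  rw [mem_shiftedPart] at hp
  have h := mem_shiftedPart.1 (hw i)
  rcases lt_or_ge t s with hts | hts
  · rw [hp.2 hts, zero_mul]
    exact zero_mem _
  rcases lt_or_ge s (b i) with hsb | hsb
  · rw [h.2 hsb, mul_zero]
    exact zero_mem _
  refine mem_shiftedPart.2 ⟨fun _ => ?_, fun h => by omega⟩
  have h1 := (hp.1 hts).mul (h.1 hsb)
  rwa [show t - s + (s - b i) = t - b i by omega] at h1

lemma single_mem_gradedVec [DecidableEq ι] (a : ι → ℕ) (i : ι) :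
    (Pi.single i 1 : ι → MvPolynomial σ K) ∈ gradedVec K σ a (a i) := by
  refine mem_gradedVec.2 fun j => ?_
  rcases eq_or_ne j i with rfl | h
  · rw [Pi.single_eq_same]
    exact mem_shiftedPart.2 ⟨fun _ => by rw [Nat.sub_self]; exact isHomogeneous_one _ _,
      fun h => absurd h (lt_irrefl _)⟩
  · rw [Pi.single_eq_of_ne h]
    exact zero_mem _

lemma isGradedMap_of_single [Finite ι] [DecidableEq ι] {a : ι → ℕ} {b : κ → ℕ}
    {φ : (ι → MvPolynomial σ K) →ₗ[MvPolynomial σ K] (κ → MvPolynomial σ K)}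
    (h : ∀ i, φ (Pi.single i 1) ∈ gradedVec K σ b (a i)) : IsGradedMap a b φ := by
  cases nonempty_fintype ι
  intro t v hv
  rw [pi_eq_sum_univ' v, map_sum]
  refine sum_mem fun i _ => ?_
  rw [map_smul]
  exact smul_mem_gradedVec (mem_gradedVec.1 hv i) (h i)

lemma IsGradedMap.comp {μ : Type*} {a : ι → ℕ} {b : κ → ℕ} {c : μ → ℕ}
    {φ : (ι → MvPolynomial σ K) →ₗ[MvPolynomial σ K] (κ → MvPolynomial σ K)}
    {ψ : (κ → MvPolynomial σ K) →ₗ[MvPolynomial σ K] (μ → MvPolynomial σ K)}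
    (hψ : IsGradedMap b c ψ) (hφ : IsGradedMap a b φ) : IsGradedMap a c (ψ ∘ₗ φ) :=
  fun t v hv => hψ t _ (hφ t v hv)

lemma IsGradedMap.symm [Finite ι] {a : ι → ℕ} {b : κ → ℕ}
    {φ : (ι → MvPolynomial σ K) ≃ₗ[MvPolynomial σ K] (κ → MvPolynomial σ K)}
    (hφ : IsGradedMap a b φ.toLinearMap) : IsGradedMap b a φ.symm.toLinearMap := by
  intro t v hv
  obtain ⟨w, rfl⟩ := φ.surjective v
  have h := hφ.vecComponent_apply t w
  rw [LinearEquiv.coe_coe, vecComponent_of_mem hv, if_pos rfl] at h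
  rw [LinearEquiv.coe_coe, LinearEquiv.symm_apply_apply, φ.injective h]
  exact vecComponent_mem a t w

lemma IsGradedMap.exists_mem_of_mem_range [Finite ι] {a : ι → ℕ} {b : κ → ℕ}
    {φ : (ι → MvPolynomial σ K) →ₗ[MvPolynomial σ K] (κ → MvPolynomial σ K)}
    (hφ : IsGradedMap a b φ) {t : ℕ} {w : κ → MvPolynomial σ K} (hw : w ∈ gradedVec K σ b t)
    (h : w ∈ LinearMap.range φ) : ∃ v ∈ gradedVec K σ a t, φ v = w := by
  obtain ⟨v, rfl⟩ := h
  refine ⟨vecComponent a t v, vecComponent_mem a t v, ?_⟩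
  rw [← hφ.vecComponent_apply, vecComponent_of_mem hw, if_pos rfl]

lemma IsGradedMap.exists_lift [Finite ι] [Finite ι'] {a : ι → ℕ} {a' : ι' → ℕ} {b : κ → ℕ}
    {φ : (ι → MvPolynomial σ K) →ₗ[MvPolynomial σ K] (κ → MvPolynomial σ K)}
    {φ' : (ι' → MvPolynomial σ K) →ₗ[MvPolynomial σ K] (κ → MvPolynomial σ K)}
    (hφ : IsGradedMap a b φ) (hφ' : IsGradedMap a' b φ')
    (h : LinearMap.range φ ≤ LinearMap.range φ') :
    ∃ Φ : (ι → MvPolynomial σ K) →ₗ[MvPolynomial σ K] (ι' → MvPolynomial σ K),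
      IsGradedMap a a' Φ ∧ φ' ∘ₗ Φ = φ := by
  classical
  have h1 : ∀ i, ∃ w ∈ gradedVec K σ a' (a i), φ' w = φ (Pi.single i 1) := fun i =>
    hφ'.exists_mem_of_mem_range (hφ _ _ (single_mem_gradedVec a i)) (h ⟨_, rfl⟩)
  choose w hw hw' using h1
  have h2 : ∀ i, (Pi.basisFun (MvPolynomial σ K) ι).constr (MvPolynomial σ K) w
      (Pi.single i 1) = w i := fun i => by
    rw [← Pi.basisFun_apply, Module.Basis.constr_basis]
  refine ⟨(Pi.basisFun (MvPolynomial σ K) ι).constr (MvPolynomial σ K) w,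
    isGradedMap_of_single fun i => ?_, (Pi.basisFun (MvPolynomial σ K) ι).ext fun i => ?_⟩
  · rw [h2]
    exact hw i
  · rw [Pi.basisFun_apply, LinearMap.comp_apply, h2, hw']

/-- For a nonzero `v`, choose `i` with `v i ≠ 0` and `a i` maximal. The entries of the matrix of `φ
- id` in row `i` and columns `j` with `v j ≠ 0` have degree `a j - a i ≤ 0` and no constant term, so
they vanish and `φ v i = v i`. -/
lemma IsGradedMap.injective_of_constantCoeff_sub [Finite ι] {a : ι → ℕ}
    {φ : (ι → MvPolynomial σ K) →ₗ[MvPolynomial σ K] (ι → MvPolynomial σ K)}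
    (hφ : IsGradedMap a a φ) (h : ∀ v i, constantCoeff (φ v i - v i) = 0) :
    Function.Injective φ := by
  classical
  cases nonempty_fintype ι
  rw [← LinearMap.ker_eq_bot, LinearMap.ker_eq_bot']
  intro v hv
  by_contra hne
  obtain ⟨i₀, hi₀⟩ := Function.ne_iff.1 hne
  obtain ⟨i, hi, hmax⟩ := (Finset.univ.filter fun i => v i ≠ 0).exists_max_image a
    ⟨i₀, by simpa using hi₀⟩
  rw [Finset.mem_filter] at hi
  refine hi.2 ?_
  have h1 : ∀ j, v j ≠ 0 → φ (Pi.single j 1) i = (Pi.single j 1 : ι → MvPolynomial σ K) i := by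
    intro j hj
    have hji := hmax j (by simpa using hj)
    have h2 := sub_mem (mem_gradedVec.1 (hφ _ _ (single_mem_gradedVec (σ := σ) (K := K) a j)) i)
      (mem_gradedVec.1 (single_mem_gradedVec (σ := σ) (K := K) a j) i)
    rw [mem_shiftedPart] at h2
    have h3 := h (Pi.single j 1) i
    rcases hji.lt_or_eq with hlt | heq
    · exact sub_eq_zero.1 (h2.2 hlt)
    · have h4 := h2.1 heq.ge
      rw [heq, Nat.sub_self] at h4
      rw [constantCoeff_eq] at h3
      rw [← sub_eq_zero, totalDegree_eq_zero_iff_eq_C.1 (Nat.le_zero.1 h4.totalDegree_le), h3,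
        map_zero]
  have h5 := congrFun hv i
  rw [pi_eq_sum_univ' v, map_sum, Finset.sum_apply, Pi.zero_apply] at h5
  rw [← h5]
  conv_lhs => rw [pi_eq_sum_univ' v, Finset.sum_apply]
  refine Finset.sum_congr rfl fun j _ => ?_
  rw [map_smul, Pi.smul_apply, Pi.smul_apply]
  rcases eq_or_ne (v j) 0 with h7 | h7
  · rw [h7, zero_smul, zero_smul]
  · rw [h1 j h7]

lemma IsGradedMap.surjective_of_injective [Finite σ] [Finite ι] {a : ι → ℕ}
    {φ : (ι → MvPolynomial σ K) →ₗ[MvPolynomial σ K] (ι → MvPolynomial σ K)}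
    (hφ : IsGradedMap a a φ) (h : Function.Injective φ) : Function.Surjective φ := by
  intro w
  obtain ⟨N, hN⟩ := exists_sum_vecComponent a w
  have h1 : ∀ t, ∃ v, φ v = vecComponent a t w := by
    intro t
    have h2 : Function.Injective ((φ.restrictScalars K).restrict (hφ t)) := fun x y hxy =>
      Subtype.ext (h (congrArg Subtype.val hxy))
    obtain ⟨v, hv⟩ := LinearMap.injective_iff_surjective.1 h2 ⟨_, vecComponent_mem a t w⟩
    exact ⟨v.1, congrArg Subtype.val hv⟩
  choose v hv using h1
  exact ⟨∑ t ∈ Finset.range N, v t, by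
    rw [map_sum, Finset.sum_congr rfl fun t _ => hv t, hN N le_rfl]⟩

/-- Graded isomorphisms lift to minimal graded covers. -/
lemma IsGradedMap.exists_equiv_lift [Finite σ] [Finite ι] [Finite ι'] [Finite κ]
    {a : ι → ℕ} {a' : ι' → ℕ} {b : κ → ℕ} {b' : κ' → ℕ}
    {D : (ι → MvPolynomial σ K) →ₗ[MvPolynomial σ K] (κ → MvPolynomial σ K)}
    {D' : (ι' → MvPolynomial σ K) →ₗ[MvPolynomial σ K] (κ' → MvPolynomial σ K)}
    (hD : IsGradedMap a b D) (hD' : IsGradedMap a' b' D')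
    (hmin : ∀ v, D v = 0 → ∀ i, constantCoeff (v i) = 0)
    (hmin' : ∀ v, D' v = 0 → ∀ i, constantCoeff (v i) = 0)
    {φ : (κ → MvPolynomial σ K) ≃ₗ[MvPolynomial σ K] (κ' → MvPolynomial σ K)}
    (hφ : IsGradedMap b b' φ.toLinearMap)
    (hrange : ∀ v, φ v ∈ LinearMap.range D' ↔ v ∈ LinearMap.range D) :
    ∃ Φ : (ι → MvPolynomial σ K) ≃ₗ[MvPolynomial σ K] (ι' → MvPolynomial σ K),
      IsGradedMap a a' Φ.toLinearMap ∧ ∀ v, D' (Φ v) = φ (D v) := by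
  obtain ⟨Φ, hΦ, h1⟩ := (hφ.comp hD).exists_lift hD' (by
    rintro _ ⟨v, rfl⟩
    exact (hrange _).2 ⟨v, rfl⟩)
  obtain ⟨Ψ, hΨ, h2⟩ := (hφ.symm.comp hD').exists_lift hD (by
    rintro _ ⟨v, rfl⟩
    rw [← hrange]
    simp)
  have h1' : ∀ v, D' (Φ v) = φ (D v) := fun v => LinearMap.congr_fun h1 v
  have h2' : ∀ v, D (Ψ v) = φ.symm (D' v) := fun v => LinearMap.congr_fun h2 v
  have h3 : Function.Injective (Ψ ∘ₗ Φ) :=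
    (hΨ.comp hΦ).injective_of_constantCoeff_sub fun v i => hmin (Ψ (Φ v) - v) (by
      rw [map_sub, h2', h1', LinearEquiv.symm_apply_apply, sub_self]) i
  have h4 : Function.Injective (Φ ∘ₗ Ψ) :=
    (hΦ.comp hΨ).injective_of_constantCoeff_sub fun v i => hmin' (Φ (Ψ v) - v) (by
      rw [map_sub, h1', h2', LinearEquiv.apply_symm_apply, sub_self]) i
  refine ⟨LinearEquiv.ofBijective Φ ⟨?_, ?_⟩, hΦ, h1'⟩
  · rw [LinearMap.coe_comp] at h3
    exact h3.of_comp
  · have h5 := (hΦ.comp hΨ).surjective_of_injective h4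
    rw [LinearMap.coe_comp] at h5
    exact h5.of_comp

lemma IsGradedMap.finrank_eq [Finite ι] {a : ι → ℕ} {b : κ → ℕ}
    {φ : (ι → MvPolynomial σ K) ≃ₗ[MvPolynomial σ K] (κ → MvPolynomial σ K)}
    (hφ : IsGradedMap a b φ.toLinearMap) (t : ℕ) :
    Module.finrank K (gradedVec K σ a t) = Module.finrank K (gradedVec K σ b t) := by
  refine (LinearEquiv.ofBijective ((φ.toLinearMap.restrictScalars K).restrict (hφ t))
    ⟨fun x y h => Subtype.ext (φ.injective (congrArg Subtype.val h)), fun w => ?_⟩).finrank_eq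
  exact ⟨⟨φ.symm w.1, hφ.symm t _ w.2⟩, Subtype.ext (φ.apply_symm_apply _)⟩

lemma IsGradedMap.degreePoly_eq [Fintype ι] [Fintype κ] {n : ℕ} {a : ι → ℕ} {b : κ → ℕ}
    {φ : (ι → MvPolynomial (Fin (n + 1)) K) ≃ₗ[MvPolynomial (Fin (n + 1)) K]
      (κ → MvPolynomial (Fin (n + 1)) K)}
    (hφ : IsGradedMap a b φ.toLinearMap) : degreePoly a = degreePoly b := by
  have h : (degreePoly a : PowerSeries ℚ) * (PowerSeries.invOneSubPow ℚ (n + 1)).val =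
      (degreePoly b : PowerSeries ℚ) * (PowerSeries.invOneSubPow ℚ (n + 1)).val := by
    ext t
    rw [← finrank_gradedVec_eq_coeff (K := K), ← finrank_gradedVec_eq_coeff (K := K),
      hφ.finrank_eq]
  exact Polynomial.coe_injective ℚ ((Units.mul_left_inj _).1 h)

end GradedComparison

/-! ### Recovering the generator degrees from their generating polynomial. -/

section DegreePoly

lemma coeff_degreePoly {ι : Type*} [Fintype ι] (a : ι → ℕ) (t : ℕ) :
    (degreePoly a).coeff t = ((Finset.univ.filter fun i => a i = t).card : ℚ) := by
  rw [degreePoly, Polynomial.finsetSum_coeff]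
  simp_rw [Polynomial.coeff_X_pow, eq_comm (a := t)]
  rw [Finset.sum_boole]

lemma eq_const_of_degreePoly_eq {ι κ : Type*} [Fintype ι] [Fintype κ] {a : ι → ℕ} {c : ℕ}
    (h : degreePoly a = degreePoly fun _ : κ => c) :
    Fintype.card ι = Fintype.card κ ∧ ∀ i, a i = c := by
  have h1 : ∀ t, (Finset.univ.filter fun i => a i = t).card =
      (Finset.univ.filter fun _ : κ => c = t).card := fun t => by
    have := congrArg (fun p => Polynomial.coeff p t) h
    simp only [coeff_degreePoly] at this
    exact_mod_cast this
  have h2 : ∀ i, a i = c := by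
    intro i
    by_contra hne
    have h3 := h1 (a i)
    rw [Finset.filter_false_of_mem fun _ _ => Ne.symm hne, Finset.card_empty,
      Finset.card_eq_zero] at h3
    exact Finset.notMem_empty i (h3 ▸ by simp)
  refine ⟨?_, h2⟩
  have h3 := h1 c
  rwa [Finset.filter_true_of_mem fun i _ => h2 i, Finset.filter_true_of_mem fun _ _ => rfl] at h3

end DegreePoly

/-! ### The homogeneous terms of the Koszul complex as graded free modules. -/

section KoszulLevels

namespace Koszul

variable {A : Type*} [CommRing A] {q : ℕ} {g : Fin q → A} (K : Koszul g)

/-- The basis of the term of homological degree `k`. -/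
abbrev Level (k : ℕ) : Type := {a : K.index // K.weight a = k}

lemma card_level (k : ℕ) : Fintype.card (K.Level k) = q.choose k := by
  rw [Fintype.card_subtype, Finset.card_filter, K.card_weight]

/-- The inclusion of the term of homological degree `k`. -/
noncomputable def incl (k : ℕ) : (K.Level k → A) →ₗ[A] (K.index → A) :=
  Function.ExtendByZero.linearMap A Subtype.val

lemma incl_val {k : ℕ} (v : K.Level k → A) (a : K.Level k) : K.incl k v a.1 = v a :=
  Subtype.val_injective.extend_apply v 0 a

lemma hasWeight_incl {k : ℕ} (v : K.Level k → A) : K.HasWeight k (K.incl k v) := fun a ha =>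
  Function.extend_apply' v (0 : K.index → A) a fun ⟨b, hb⟩ => ha (hb ▸ b.2)

lemma incl_comp_val {k : ℕ} {v : K.index → A} (hv : K.HasWeight k v) :
    K.incl k (fun a => v a.1) = v := by
  ext a
  by_cases ha : K.weight a = k
  · exact K.incl_val _ ⟨a, ha⟩
  · rw [hv a ha, K.hasWeight_incl _ a ha]

lemma incl_single {k : ℕ} (a : K.Level k) : K.incl k (Pi.single a 1) = Pi.single a.1 1 := by
  ext b
  by_cases hb : K.weight b = k
  · rw [show b = (⟨b, hb⟩ : K.Level k).1 from rfl, K.incl_val, Pi.single_apply, Pi.single_apply]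
    simp only [Subtype.ext_iff]
  · rw [K.hasWeight_incl _ b hb, Pi.single_eq_of_ne]
    rintro rfl
    exact hb a.2

/-- The differential between the terms of homological degrees `k + 1` and `k`. -/
noncomputable def levelDiff (k : ℕ) : (K.Level (k + 1) → A) →ₗ[A] (K.Level k → A) :=
  LinearMap.funLeft A A Subtype.val ∘ₗ K.diff ∘ₗ K.incl (k + 1)

lemma levelDiff_apply (k : ℕ) (v : K.Level (k + 1) → A) (a : K.Level k) :
    K.levelDiff k v a = K.diff (K.incl (k + 1) v) a.1 := rfl

lemma incl_levelDiff (k : ℕ) (v : K.Level (k + 1) → A) :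
    K.incl k (K.levelDiff k v) = K.diff (K.incl (k + 1) v) :=
  K.incl_comp_val (K.diff_weight k _ (K.hasWeight_incl v))

lemma levelDiff_single_mem (P : AddSubgroup A) (hP : ∀ j, g j ∈ P) (k : ℕ) (a : K.Level (k + 1))
    (b : K.Level k) : K.levelDiff k (Pi.single a 1) b ∈ P := by
  rw [levelDiff_apply, incl_single]
  exact K.diff_mem P hP _ _

lemma exact_levelDiff {k : ℕ} (h : K.ExactMod ⊥ (k + 1)) :
    Function.Exact (K.levelDiff (k + 1)) (K.levelDiff k) := by
  intro v
  constructor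
  · intro hv
    have h1 : K.diff (K.incl (k + 1) v) = 0 := by rw [← incl_levelDiff, hv, map_zero]
    obtain ⟨u, hu, hu'⟩ := h _ (K.hasWeight_incl v) (fun a => by rw [h1]; exact zero_mem _)
    refine ⟨fun a => u a.1, ?_⟩
    ext a
    rw [levelDiff_apply, K.incl_comp_val hu, ← K.incl_val v a]
    have h2 := hu' a.1
    rw [Ideal.mem_bot, Pi.sub_apply, sub_eq_zero] at h2
    exact h2.symm
  · rintro ⟨u, rfl⟩
    ext a
    rw [levelDiff_apply, incl_levelDiff, K.diff_diff]
    rfl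

/-- The basis elements of weight one. -/
noncomputable def genEquiv : Fin q ≃ K.Level 1 :=
  Equiv.ofBijective (fun j => ⟨K.gen j, K.weight_gen j⟩)
    ⟨fun _ _ h => K.gen_injective (congrArg Subtype.val h), fun a => by
      obtain ⟨j, hj⟩ := K.exists_gen a.1 a.2
      exact ⟨j, Subtype.ext hj⟩⟩

lemma genEquiv_val (j : Fin q) : (K.genEquiv j).1 = K.gen j := rfl

lemma levelDiff_zero_eq_zero_iff (v : K.Level 1 → A) :
    K.levelDiff 0 v = 0 ↔ ∑ j, v (K.genEquiv j) * g j = 0 := by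
  have h : ∀ b : K.Level 0, K.levelDiff 0 v b = ∑ j, v (K.genEquiv j) * g j := by
    intro b
    conv_lhs => rw [pi_eq_sum_univ' v, map_sum, Finset.sum_apply]
    rw [← K.genEquiv.sum_comp]
    refine Finset.sum_congr rfl fun j _ => ?_
    rw [map_smul, Pi.smul_apply, smul_eq_mul, levelDiff_apply, incl_single, genEquiv_val,
      K.eq_base b.1 b.2, K.diff_gen]
  constructor
  · intro h0
    rw [← h ⟨K.base, K.weight_base⟩, h0]
    rfl
  · intro h0
    ext b
    rw [h, h0]
    rfl

end Koszul

open MvPolynomial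

variable {σ F : Type*} [Field F] {q e : ℕ} {g : Fin q → MvPolynomial σ F} (K : Koszul g)

lemma Koszul.isGradedMap_levelDiff (hg : ∀ j, (g j).IsHomogeneous e) (k : ℕ) :
    IsGradedMap (fun _ => (k + 1) * e) (fun _ => k * e) (K.levelDiff k) := by
  refine isGradedMap_of_single fun a => mem_gradedVec.2 fun b => mem_shiftedPart.2 ⟨fun _ => ?_,
    fun h => absurd h (by nlinarith)⟩
  rw [add_one_mul, Nat.add_sub_cancel_left]
  exact K.levelDiff_single_mem (homogeneousSubmodule σ F e).toAddSubgroup hg k a b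

lemma Koszul.constantCoeff_levelDiff (hg : ∀ j, constantCoeff (g j) = 0) (k : ℕ)
    (v : K.Level (k + 1) → MvPolynomial σ F) (b : K.Level k) :
    constantCoeff (K.levelDiff k v b) = 0 := by
  rw [pi_eq_sum_univ' v, map_sum, Finset.sum_apply, map_sum]
  refine Finset.sum_eq_zero fun a _ => ?_
  have h : constantCoeff (K.levelDiff k (Pi.single a 1) b) = 0 :=
    K.levelDiff_single_mem (constantCoeff (σ := σ) (R := F)).toAddMonoidHom.ker hg k a b
  rw [map_smul, Pi.smul_apply, smul_eq_mul, map_mul, h, mul_zero]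

end KoszulLevels

/-! ### Smoothness implies Koszul numerics. -/

namespace MinimalResolution

open MvPolynomial

variable {n d : ℕ} {f : PolyRing n} (R : MinimalResolution d f)

/-- Compare the minimal resolution with the Koszul complex of the partial derivatives. -/
lemma exists_equiv_koszul (hd : 2 ≤ d) (hf : f.IsHomogeneous d) (h : IsSmoothHypersurface f)
    (k : ℕ) :
    ∃ Φ : (Fin (R.m k) → PolyRing n) ≃ₗ[PolyRing n]
        ((koszul fun i => pderiv i f).Level (k + 1) → PolyRing n),
      IsGradedMap (R.genDeg k) (fun _ => (k + 1) * (d - 1)) Φ.toLinearMap ∧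
        ∀ v, Φ v ∈ LinearMap.range ((koszul fun i => pderiv i f).levelDiff (k + 1)) ↔
          v ∈ LinearMap.range (R.diff k) := by
  set K := koszul fun i => pderiv i f
  have hg : ∀ i, (pderiv i f).IsHomogeneous (d - 1) := fun i => hf.pderiv
  have hg0 : ∀ i, constantCoeff (pderiv i f) = 0 := fun i =>
    IsHomogeneous.constantCoeff_eq_zero (hg i) (by omega)
  have hex : ∀ k, Function.Exact (K.levelDiff (k + 1)) (K.levelDiff k) := fun k =>
    K.exact_levelDiff (koszul_exactMod_bot_of_X_mem_radical
      (X_mem_radical_of_smooth hf (by omega) h) k.succ_pos)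
  -- `E_k` is matched with the Koszul term of degree `k + 1`, since the Koszul term of degree `0` is
  -- `S`. Carrying the images of the next differentials along makes the next lift possible; for `k =
  -- 0` both are the syzygies of the partials.
  induction k with
  | zero =>
    refine ⟨LinearEquiv.funCongrLeft (PolyRing n) (PolyRing n)
      (K.genEquiv.symm.trans (finCongr R.rank_zero.symm)), fun t v hv => ?_, fun v => ?_⟩
    · rw [mem_gradedVec] at hv ⊢
      intro a
      have h1 := hv ((K.genEquiv.symm.trans (finCongr R.rank_zero.symm)) a)
      rwa [genDeg, R.deg_zero, add_zero, show d - 1 = (0 + 1) * (d - 1) by omega] at h1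
    · rw [LinearMap.mem_range, LinearMap.mem_range, ← Set.mem_range, ← Set.mem_range, ← hex 0 _,
        ← R.exact_zero v, K.levelDiff_zero_eq_zero_iff, ← (finCongr R.rank_zero).sum_comp]
      simp [LinearEquiv.funCongrLeft_apply, LinearMap.funLeft_apply]
  | succ k ih =>
    obtain ⟨φ, hφ, hrange⟩ := ih
    obtain ⟨Φ, hΦ, hcomm⟩ := IsGradedMap.exists_equiv_lift (R.isGradedMap_diff k)
      (K.isGradedMap_levelDiff hg (k + 1))
      (fun v hv i => by
        obtain ⟨w, rfl⟩ := (R.exact k v).1 hv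
        -- Only minimality at `E_{k+1}` with `k + 1 ≥ 1` enters, consistent with nothing being asked
        -- of `E_1 → E_0`.
        exact R.minimal (k + 1) (by omega) w i)
      (fun v hv i => by
        obtain ⟨w, rfl⟩ := (hex (k + 1) v).1 hv
        exact K.constantCoeff_levelDiff hg0 _ w i) hφ hrange
    refine ⟨Φ, hΦ, fun v => ?_⟩
    rw [LinearMap.mem_range, LinearMap.mem_range, ← Set.mem_range, ← Set.mem_range,
      ← hex (k + 1) _, ← R.exact k v, hcomm, LinearEquiv.map_eq_zero_iff]

lemma koszul_of_smooth (hd : 2 ≤ d) (hf : f.IsHomogeneous d) (h : IsSmoothHypersurface f)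
    (k : ℕ) : R.m k = (n + 1).choose (k + 1) ∧ ∀ i, R.deg k i = k * (d - 1) := by
  obtain ⟨Φ, hΦ, -⟩ := R.exists_equiv_koszul hd hf h k
  obtain ⟨h1, h2⟩ := eq_const_of_degreePoly_eq hΦ.degreePoly_eq
  rw [Fintype.card_fin, Koszul.card_level] at h1
  refine ⟨h1, fun i => ?_⟩
  have h3 := h2 i
  rw [genDeg, add_one_mul] at h3
  omega

end MinimalResolution

end JacobianHypersurface

theorem theorem1p1 (n d : ℕ) (hn : 2 ≤ n) (hd : 3 ≤ d)
    (f : JacobianHypersurface.PolyRing n) (hf : f.IsHomogeneous d) (hred : Squarefree f)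
    (R : JacobianHypersurface.MinimalResolution d f) :
    (R.sigma 0 = (n : ℤ) ∧ R.sigma 1 = (d : ℤ) - 1) ∧
    (∀ δ : ℕ, δ ≤ n - 2 →
      (JacobianHypersurface.singularDim f = (δ : WithBot ℕ∞) ↔
        (∀ j : ℕ, 1 ≤ j → j < n - δ → R.sigma j = (-1) ^ (j + 1) * ((d : ℤ) - 1) ^ j) ∧
          R.sigma (n - δ) ≠ (-1) ^ (n - δ + 1) * ((d : ℤ) - 1) ^ (n - δ)) ∧
      (JacobianHypersurface.singularDim f = (δ : WithBot ℕ∞) →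
        JacobianHypersurface.HasSingularDegree f
          ((((d : ℚ) - 1) ^ (n - δ) + (-1) ^ (n - δ) * (R.sigma (n - δ) : ℚ)) /
            ((n - δ).factorial : ℚ)) ∧
        0 < (((d : ℚ) - 1) ^ (n - δ) + (-1) ^ (n - δ) * (R.sigma (n - δ) : ℚ)) /
            ((n - δ).factorial : ℚ))) ∧
    (JacobianHypersurface.IsSmoothHypersurface f ↔
      ∀ k : ℕ, 1 ≤ k → k ≤ n →
        R.m k = (n + 1).choose (k + 1) ∧ ∀ i, R.deg k i = k * (d - 1)) :=
  ⟨R.sigma_zero_one hn hd hf hred,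
    fun _ hδ => ⟨R.singularDim_iff hn hd hf hred hδ, R.degree_formula hn hd hf hδ⟩,
    fun h k _ _ => R.koszul_of_smooth (by omega) hf h k, R.smooth_of_koszul (by omega) hf⟩
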